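/- Let $\mathbb N^\times=\{1,2,3,\dots\}$ and consider the following sets with two binary operations. * The ghost ring $\prod_{\mathbb N^\times}\mathbb C$ of sequences $(x_n)_{n\ge1}$, with componentwise addition and multiplication. * $z\mathbb C[[z]]$, with addition and multiplication coefficient by coefficient. * $\Lambda(\mathbb C)=1+z\mathbb C[[z]]$, whose addition is the multiplication of power series and whose multiplication $\ast$ is determined by formal factorisations: if $f=\prod_i(1-\xi_iz)^{-1}$ and $g=\prod_j(1-\eta_jz)^{-1}$, then $f\ast g=\prod_{i,j}(1-\xi_i\eta_jz)^{-1}$. (The $n$-th coefficient of $f\ast g$ depends only on $f$ and $g$ modulo $z^{n+1}$ and is computed from finite factorisations modulo $z^{n+1}$.) * $\operatorname{W}(\mathbb C)$, the set of sequences $a=(a_n)_{n\ge1}$, with the operations transported from $\Lambda(\mathbb C)$ along $\gamma(a)=\prod_{n\ge1}(1-a_nz^n)^{-1}$. * $\operatorname{Nr}(\mathbb C)$, the set of sequences $\alpha=(\alpha_n)_{n\ge1}$, with componentwise addition and the product $(\alpha\ast_{\mathrm{MR}}\beta)_n=\sum_{\operatorname{lcm}(i,j)=n}\gcd(i,j)\,\alpha_i\beta_j$.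 * $\Sigma$, the set of linear $\mu:\mathbb C[X]\to\mathbb C$ with $\mu(1)=1$, with addition the free additive convolution $\boxplus$ and multiplication $\mu\boxdot\nu=R^{-1}(R_\mu\cdot R_\nu)$, the product being that of $z\mathbb C[[z]]$ above. * $\Sigma_1^\times=\{\mu\in\Sigma:\mu(X)=1\}$, with addition the free multiplicative convolution $\boxtimes$ and multiplication $\mu\circledast\nu=S^{-1}(S_\mu\ast S_\nu)$. Here a non-commutative probability space is a unital $\mathbb C$-algebra $\mathcal A$ with a linear functional $\phi$ such that $\phi(1)=1$; the law of $a\in\mathcal A$ is $\mu_a(X^n)=\phi(a^n)$; and $a,b$ are free if $\phi(a_1\cdots a_n)=0$ for all $n\ge1$ whenever $\phi(a_j)=0$ for all $j$, each $a_j$ lies in the unital subalgebra generated by $a$ or in the one generated by $b$, and consecutive factors are taken from different ones of these two. The law $\mu\boxplus\nu$ (respectively $\mu\boxtimes\nu$) is the law of $a+b$ (respectively $ab$) for free $a,b$ with laws $\mu,\nu$. With $m_n=\mu(X^n)$, the $R$-transform is $R_\mu(z)=z\,(G_\mu^{-1}(z)-1/z)$, where $G_\mu^{-1}$ is the compositional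 inverse of $G_\mu(z)=\sum_{n\ge0}m_nz^{-n-1}$, and, for $\mu\in\Sigma_1^\times$, $S_\mu(z)=\frac{1+z}{z}M_\mu^{-1}(z)$, where $M_\mu^{-1}$ is the compositional inverse of $M_\mu(z)=\sum_{n\ge1}m_nz^n$. Then: 1. Any two laws in $\Sigma$ are the laws of a free pair in some non-commutative probability space, and the laws of $a+b$ and (for laws of mean one) $ab$ for free $a,b$ depend only on the laws of $a$ and $b$, so $\boxplus$ on $\Sigma$ and $\boxtimes$ on $\Sigma_1^\times$ are well defined, the latter with values in $\Sigma_1^\times$. 2. All seven structures are commutative unital rings. 3. The following maps are isomorphisms of commutative unital rings: $$\gamma:\operatorname{W}(\mathbb C)\to\Lambda(\mathbb C),\qquad w:\operatorname{W}(\mathbb C)\to\prod_{\mathbb N^\times}\mathbb C,\quad w(a)_n=\sum_{d\mid n}d\,a_d^{n/d},$$ $$f:\operatorname{W}(\mathbb C)\to\operatorname{Nr}(\mathbb C),\quad f(a)=\sum_{n\ge1}V_n\mathbf M(a_n),\qquad g:\operatorname{Nr}(\mathbb C)\to\prod_{\mathbb N^\times}\mathbb C,\quad g(\alpha)_n=\sum_{d\mid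 n}d\,\alpha_d,$$ $$c:\operatorname{Nr}(\mathbb C)\to\Lambda(\mathbb C),\quad c(\alpha)=\prod_{n\ge1}(1-z^n)^{-\alpha_n},\qquad \gamma^w:\prod_{\mathbb N^\times}\mathbb C\to z\mathbb C[[z]],\quad \gamma^w(x)=\sum_{n\ge1}x_nz^n,$$ $$z\tfrac{d}{dz}\log:\Lambda(\mathbb C)\to z\mathbb C[[z]],\qquad S:\Sigma_1^\times\to\Lambda(\mathbb C),\qquad R^{-1}:z\mathbb C[[z]]\to\Sigma,\qquad \operatorname{LOG}:=R^{-1}\circ z\tfrac{d}{dz}\log\circ S:\Sigma_1^\times\to\Sigma,$$ where $\mathbf M(b)_n=\frac1n\sum_{d\mid n}\tilde\mu(n/d)\,b^d$ with the Möbius function $\tilde\mu$, and $(V_r\alpha)_n=\alpha_{n/r}$ if $r\mid n$ and $0$ otherwise. 4. The diagram formed by these maps commutes: $c\circ f=\gamma$, $g\circ f=w$, $z\frac{d}{dz}\log\circ\gamma=\gamma^w\circ w$, and $z\frac{d}{dz}\log\circ c=\gamma^w\circ g$, the common value being a ring isomorphism $\operatorname{Nr}(\mathbb C)\to z\mathbb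 C[[z]]$. -/

import Mathlib

noncomputable section

namespace FreeWitt

open scoped PowerSeries.WithPiTopology

/-! ## The sets and rings on the algebraic side -/

/-- The Witt vectors `(a₁, a₂, …)` with complex entries. -/
@[ext] structure Witt where
  comp : ℕ+ → ℂ

/-- The set `Λ(ℂ) = 1 + z ℂ[[z]]`. -/
@[ext] structure Lambda where
  series : PowerSeries ℂ
  const : PowerSeries.constantCoeff series = 1

/-- The necklace sequences `(α₁, α₂, …)` with complex entries. -/
@[ext] structure Necklace where
  comp : ℕ+ → ℂ

/-- The set `z ℂ[[z]]`. -/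
@[ext] structure ZSeries where
  series : PowerSeries ℂ
  const : PowerSeries.constantCoeff series = 0

/-- The positive divisors of `n`. -/
def divisors (n : ℕ+) : Finset ℕ+ := (Finset.Icc 1 n).filter (fun d => (d : ℕ) ∣ (n : ℕ))

/-! ### The necklace ring: componentwise addition, product indexed by least common multiples -/

instance : Add Necklace := ⟨fun α β => ⟨fun n => α.comp n + β.comp n⟩⟩

instance : Mul Necklace := ⟨fun α β => ⟨fun n =>
  ∑ p ∈ ((Finset.Icc 1 n) ×ˢ (Finset.Icc 1 n)).filter (fun p => PNat.lcm p.1 p.2 = n),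
    ((PNat.gcd p.1 p.2 : ℕ+) : ℂ) * α.comp p.1 * β.comp p.2⟩⟩

/-! ### `z ℂ[[z]]` as ghost ring: addition and multiplication coefficient by coefficient -/

instance : Add ZSeries := ⟨fun f g => ⟨f.series + g.series, by simp [f.const, g.const]⟩⟩

instance : Mul ZSeries := ⟨fun f g =>
  ⟨PowerSeries.mk fun n => PowerSeries.coeff n f.series * PowerSeries.coeff n g.series, by
    rw [← PowerSeries.coeff_zero_eq_constantCoeff_apply, PowerSeries.coeff_mk,
      PowerSeries.coeff_zero_eq_constantCoeff_apply, f.const, zero_mul]⟩⟩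

/-! ### `Λ(ℂ)` -/

/-- The numbers `ξ₁, …, ξ_N` (with multiplicity, zeros omitted) for which
`f = ∏ᵢ (1 - ξᵢ z)⁻¹` modulo `z ^ (n + 1)`: if `P` is the polynomial of degree at most `n` with
`P = 1 / f` modulo `z ^ (n + 1)`, then `P = ∏ᵢ (1 - ξᵢ z)`, so that the `ξᵢ` are the roots of
the reversed polynomial. -/
def formalRoots (n : ℕ) (f : PowerSeries ℂ) : Multiset ℂ :=
  (PowerSeries.trunc (n + 1) f⁻¹).reverse.roots

/-- The product `∏_{i,j} (1 - ξᵢ ηⱼ z)⁻¹` of `f = ∏ᵢ (1 - ξᵢ z)⁻¹` and `g = ∏ⱼ (1 - ηⱼ z)⁻¹`.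
Its `n`-th coefficient depends only on `f` and `g` modulo `z ^ (n + 1)`, and is computed from
factorisations of these truncations. -/
def lambdaMul (f g : PowerSeries ℂ) : PowerSeries ℂ :=
  PowerSeries.mk fun n => PowerSeries.coeff n
    (((formalRoots n f) ×ˢ (formalRoots n g)).map
      fun p => (1 - PowerSeries.C (p.1 * p.2) * PowerSeries.X)⁻¹).prod

theorem constantCoeff_lambdaMul (f g : PowerSeries ℂ) :
    PowerSeries.constantCoeff (lambdaMul f g) = 1 := by
  rw [← PowerSeries.coeff_zero_eq_constantCoeff_apply, lambdaMul, PowerSeries.coeff_mk,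
    PowerSeries.coeff_zero_eq_constantCoeff_apply, map_multiset_prod]
  apply Multiset.prod_eq_one
  intro x hx
  simp only [Multiset.map_map, Multiset.mem_map] at hx
  obtain ⟨p, -, rfl⟩ := hx
  simp [PowerSeries.constantCoeff_inv]

/-- The additive structure of `Λ(ℂ)` is the multiplication of power series. -/
instance : Add Lambda := ⟨fun f g => ⟨f.series * g.series, by simp [f.const, g.const]⟩⟩

instance : Mul Lambda := ⟨fun f g =>
  ⟨lambdaMul f.series g.series, constantCoeff_lambdaMul f.series g.series⟩⟩

/-- An infinite product of power series with constant coefficient `1` has constant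
coefficient `1`. -/
theorem constantCoeff_tprod (u : ℕ+ → PowerSeries ℂ)
    (hu : ∀ n, PowerSeries.constantCoeff (u n) = 1) :
    PowerSeries.constantCoeff (∏' n, u n) = 1 := by
  by_cases h : Multipliable u
  · rw [h.map_tprod (PowerSeries.constantCoeff (R := ℂ))
      (PowerSeries.WithPiTopology.continuous_constantCoeff ℂ)]
    simp [hu]
  · rw [tprod_eq_one_of_not_multipliable h, map_one]

/-! ### The maps -/

/-- `γ (a) = ∏ₙ (1 - aₙ zⁿ)⁻¹`. -/
def gamma (a : Witt) : Lambda where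
  series := ∏' n : ℕ+, (1 - PowerSeries.C (a.comp n) * PowerSeries.X ^ (n : ℕ))⁻¹
  const := constantCoeff_tprod _ fun n => by simp [PowerSeries.constantCoeff_inv]

instance : Nonempty Witt := ⟨⟨0⟩⟩

/-- The ring operations on the Witt vectors are those of `Λ(ℂ)`, transported along `γ`. -/
instance : Add Witt := ⟨fun a b => Function.invFun gamma (gamma a + gamma b)⟩

instance : Mul Witt := ⟨fun a b => Function.invFun gamma (gamma a * gamma b)⟩

/-- The ghost map `w (a)ₙ = ∑_{d ∣ n} d a_d ^ (n / d)`. -/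
def ghostMap (a : Witt) : ℕ+ → ℂ := fun n =>
  ∑ d ∈ divisors n, (d : ℂ) * a.comp d ^ ((n : ℕ) / (d : ℕ))

/-- `γʷ (x) = ∑ₙ xₙ zⁿ`. -/
def ghostSeries (x : ℕ+ → ℂ) : ZSeries where
  series := PowerSeries.mk fun n => if h : 0 < n then x ⟨n, h⟩ else 0
  const := by
    rw [← PowerSeries.coeff_zero_eq_constantCoeff_apply, PowerSeries.coeff_mk]
    simp

/-- The necklace polynomial `M (x, n) = (1 / n) ∑_{d ∣ n} μ (n / d) x ^ d`, evaluated at `b`;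
as a function of `n` this is the sequence `𝐌 (b)`. -/
def necklaceVector (b : ℂ) : Necklace where
  comp n := (1 / (n : ℂ)) *
    ∑ d ∈ divisors n, (ArithmeticFunction.moebius ((n : ℕ) / (d : ℕ)) : ℂ) * b ^ (d : ℕ)

/-- The Verschiebung `V_r`. -/
def verschiebung (r : ℕ+) (α : Necklace) : Necklace where
  comp n := if (r : ℕ) ∣ (n : ℕ) then α.comp (Nat.toPNat' ((n : ℕ) / (r : ℕ))) else 0

/-- `f (a) = ∑ₙ Vₙ 𝐌 (aₙ)`; in each component only finitely many terms do not vanish. -/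
def wittToNecklace (a : Witt) : Necklace where
  comp m := ∑ᶠ n : ℕ+, (verschiebung n (necklaceVector (a.comp n))).comp m

/-- `g (α)ₙ = ∑_{d ∣ n} d α_d`. -/
def necklaceGhost (α : Necklace) : ℕ+ → ℂ := fun n => ∑ d ∈ divisors n, (d : ℂ) * α.comp d

/-- `c (α) = ∏ₙ (1 - zⁿ) ^ (-αₙ)`, the powers being given by the binomial series. -/
def necklaceLambda (α : Necklace) : Lambda where
  series := ∏' n : ℕ+, (PowerSeries.binomialSeries ℂ (-(α.comp n))).subst
    (-(PowerSeries.X ^ (n : ℕ)) : PowerSeries ℂ)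
  const := constantCoeff_tprod _ fun n => by
    have h : PowerSeries.constantCoeff (-(PowerSeries.X ^ (n : ℕ)) : PowerSeries ℂ) = 0 := by
      simp
    have hs : PowerSeries.HasSubst (-(PowerSeries.X ^ (n : ℕ)) : PowerSeries ℂ) :=
      PowerSeries.HasSubst.of_constantCoeff_zero' h
    have key : PowerSeries.constantCoeff
        ((PowerSeries.binomialSeries ℂ (-(α.comp n)) - 1).subst
          (-(PowerSeries.X ^ (n : ℕ)) : PowerSeries ℂ)) = 0 :=
      PowerSeries.constantCoeff_subst_eq_zero h _ (by simp)
    rw [PowerSeries.subst_sub hs, map_sub, ← PowerSeries.coe_substAlgHom hs, map_one,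
      map_one, sub_eq_zero] at key
    rw [← PowerSeries.coe_substAlgHom hs]
    exact key

/-- The map `z (d/dz) log : Λ(ℂ) → z ℂ[[z]]`. -/
def zdlog (f : Lambda) : ZSeries where
  series := PowerSeries.X * PowerSeries.derivative ℂ (PowerSeries.logOf f.series)
  const := by simp

/-! ## Free probability -/

/-- The set `Σ` of linear functionals on `ℂ[X]` with `μ (1) = 1`. -/
@[ext] structure Law where
  toLin : Polynomial ℂ →ₗ[ℂ] ℂ
  map_one : toLin 1 = 1

/-- The set `Σ₁ˣ` of linear functionals on `ℂ[X]` with `μ (1) = 1` and mean `μ (X) = 1`. -/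
@[ext] structure LawOne extends Law where
  mean : toLin Polynomial.X = 1

instance : Nonempty Law := ⟨⟨(Polynomial.aeval (0 : ℂ)).toLinearMap, by simp⟩⟩

instance : Nonempty LawOne := ⟨⟨⟨(Polynomial.aeval (1 : ℂ)).toLinearMap, by simp⟩, by simp⟩⟩

/-- The `n`-th moment. -/
def Law.moment (μ : Law) (n : ℕ) : ℂ := μ.toLin (Polynomial.X ^ n)

/-- A non-commutative probability space on the unital `ℂ`-algebra `A`: a linear functional
`φ` with `φ (1) = 1`. -/
structure NCProbSpace (A : Type*) [Ring A] [Algebra ℂ A] where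
  φ : A →ₗ[ℂ] ℂ
  map_one : φ 1 = 1

namespace NCProbSpace

variable {A : Type*} [Ring A] [Algebra ℂ A]

/-- The distribution of `a`, i.e. the functional on `ℂ[X]` with `Xⁿ ↦ φ (aⁿ)`. -/
def law (P : NCProbSpace A) (a : A) : Law where
  toLin := P.φ ∘ₗ (Polynomial.aeval a).toLinearMap
  map_one := by simp [P.map_one]

/-- Freeness of a family of unital subalgebras: `φ (a₁ ⋯ aₙ) = 0` for all `n ≥ 1` whenever each
`a_j` is centred and lies in the subalgebra of index `i_j`, and consecutive indices differ. -/
def FreeFamily (P : NCProbSpace A) {ι : Type*} (S : ι → Subalgebra ℂ A) : Prop :=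
  ∀ l : List (ι × A), l ≠ [] → l.IsChain (fun p q => p.1 ≠ q.1) →
    (∀ p ∈ l, p.2 ∈ S p.1 ∧ P.φ p.2 = 0) → P.φ (l.map Prod.snd).prod = 0

/-- Two random variables are free if the unital subalgebras that they generate are. -/
def FreePair (P : NCProbSpace A) (a b : A) : Prop :=
  P.FreeFamily fun i : Fin 2 => Algebra.adjoin ℂ {![a, b] i}

end NCProbSpace

/-- `ρ` is the distribution of `a + b` for some free `a`, `b` with distributions `μ`, `ν`. -/
def IsFreeAddConv (μ ν ρ : Law) : Prop :=
  ∃ (A : Type) (_ : Ring A) (_ : Algebra ℂ A) (P : NCProbSpace A) (a b : A),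
    P.FreePair a b ∧ P.law a = μ ∧ P.law b = ν ∧ P.law (a + b) = ρ

/-- `ρ` is the distribution of `a b` for some free `a`, `b` with distributions `μ`, `ν`. -/
def IsFreeMulConv (μ ν ρ : Law) : Prop :=
  ∃ (A : Type) (_ : Ring A) (_ : Algebra ℂ A) (P : NCProbSpace A) (a b : A),
    P.FreePair a b ∧ P.law a = μ ∧ P.law b = ν ∧ P.law (a * b) = ρ

/-- The additive free convolution `μ ⊞ ν`. -/
def freeAddConv (μ ν : Law) : Law := Classical.epsilon fun ρ => IsFreeAddConv μ ν ρ

/-- The multiplicative free convolution `μ ⊠ ν` of laws of mean one. -/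
def freeMulConv (μ ν : LawOne) : LawOne :=
  Classical.epsilon fun ρ => IsFreeMulConv μ.toLaw ν.toLaw ρ.toLaw

/-! ### The `R`- and the `S`-transform -/

/-- `f (z) / z` for a power series `f` without constant term. -/
def divZ (f : PowerSeries ℂ) : PowerSeries ℂ :=
  PowerSeries.mk fun n => PowerSeries.coeff (n + 1) f

/-- The Cauchy transform `G (z) = ∑ mₙ z ^ (-(n + 1))`, as a power series in `u = 1 / z`. -/
def cauchySeries (μ : Law) : PowerSeries ℂ :=
  PowerSeries.X * PowerSeries.mk μ.moment

theorem isUnit_coeff_one_cauchySeries (μ : Law) :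
    IsUnit (PowerSeries.coeff 1 (cauchySeries μ)) := by
  have h : PowerSeries.coeff (0 + 1) (cauchySeries μ) = 1 := by
    rw [cauchySeries, PowerSeries.coeff_succ_X_mul]
    simp [Law.moment, μ.map_one]
  simp [show PowerSeries.coeff 1 (cauchySeries μ) = 1 from h]

/-- The compositional inverse `h` of `cauchySeries μ`. As `G (z) = (cauchySeries μ) (1 / z)`, the
compositional inverse of the Cauchy transform is `G⁻¹ (z) = 1 / h (z)`. -/
def cauchyInv (μ : Law) : PowerSeries ℂ :=
  (cauchySeries μ).substInvOfIsUnit (isUnit_coeff_one_cauchySeries μ)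

/-- The `R`-transform `R (z) = z (G⁻¹ (z) - 1 / z) = z / h (z) - 1`, with `h` as above. -/
def rTransform (μ : Law) : ZSeries where
  series := (divZ (cauchyInv μ))⁻¹ - 1
  const := by
    have h : PowerSeries.coeff (0 + 1) (cauchySeries μ) = 1 := by
      rw [cauchySeries, PowerSeries.coeff_succ_X_mul]
      simp [Law.moment, μ.map_one]
    rw [zero_add] at h
    have h1 : PowerSeries.constantCoeff (divZ (cauchyInv μ)) = 1 := by
      rw [← PowerSeries.coeff_zero_eq_constantCoeff_apply, divZ, PowerSeries.coeff_mk, zero_add,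
        cauchyInv, PowerSeries.coeff_one_substInvOfIsUnit]
      have e : (isUnit_coeff_one_cauchySeries μ).unit = 1 := Units.ext h
      rw [e]
      simp
    simp [PowerSeries.constantCoeff_inv, h1]

/-- The moment series `M (z) = ∑_{n ≥ 1} mₙ zⁿ`. -/
def momentSeries (μ : Law) : PowerSeries ℂ :=
  PowerSeries.mk fun n => if n = 0 then 0 else μ.moment n

theorem coeff_one_momentSeries (μ : LawOne) :
    PowerSeries.coeff 1 (momentSeries μ.toLaw) = 1 := by
  simp [momentSeries, Law.moment, μ.mean]

/-- The compositional inverse of the moment series. -/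
def momentInv (μ : LawOne) : PowerSeries ℂ :=
  (momentSeries μ.toLaw).substInvOfIsUnit (by simp [coeff_one_momentSeries])

/-- The `S`-transform `S (z) = ((1 + z) / z) M⁻¹ (z)`. -/
def sTransform (μ : LawOne) : Lambda where
  series := (1 + PowerSeries.X) * divZ (momentInv μ)
  const := by
    have hu : IsUnit (PowerSeries.coeff 1 (momentSeries μ.toLaw)) := by
      simp [coeff_one_momentSeries]
    have h1 : PowerSeries.constantCoeff (divZ (momentInv μ)) = 1 := by
      rw [← PowerSeries.coeff_zero_eq_constantCoeff_apply, divZ, PowerSeries.coeff_mk, zero_add,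
        momentInv, PowerSeries.coeff_one_substInvOfIsUnit]
      have e : hu.unit = 1 := Units.ext (coeff_one_momentSeries μ)
      rw [e]
      simp
    simp [h1]

/-! ### The ring operations on laws -/

/-- Addition on `Σ` is `⊞`. -/
instance : Add Law := ⟨freeAddConv⟩

/-- Multiplication on `Σ` is `μ ⊡ ν = R⁻¹ (R μ · R ν)`, with the product of the ghost ring
`z ℂ[[z]]`. -/
instance : Mul Law := ⟨fun μ ν => Function.invFun rTransform (rTransform μ * rTransform ν)⟩

/-- Addition on `Σ₁ˣ` is `⊠`. -/
instance : Add LawOne := ⟨freeMulConv⟩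

/-- Multiplication on `Σ₁ˣ` is `μ ⊛ ν = S⁻¹ (S μ ∗ S ν)`, with the product of `Λ(ℂ)`. -/
instance : Mul LawOne := ⟨fun μ ν => Function.invFun sTransform (sTransform μ * sTransform ν)⟩

/-- The given addition and multiplication are those of a commutative ring with unit. -/
def IsCommUnitalRing (R : Type*) [Add R] [Mul R] : Prop :=
  ∃ inst : CommRing R, (∀ a b : R, inst.add a b = a + b) ∧ ∀ a b : R, inst.mul a b = a * b

end FreeWitt

end

/-! Every structure is compared with the ghost ring of sequences, where the ring axioms are evident;
a bijection compatible with both operations transports them back.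

On the algebraic side the comparison is the logarithmic derivative `F = z f'/f`, used through the
equation `F f = z f'` (`IsLogDeriv`). This equation turns products into sums, and, when `f` has
constant term 1, `F` and `f` determine each other up to any given order (`coeff_eq`, `coeff_eq'`).
Applied factor by factor to the infinite products, it yields the two ghost maps, which are bijective
because they are triangular with diagonal entries `n`. For a finite factorisation its coefficients
are the power sums of the `ξᵢ`, and power sums of the `ξᵢ ηⱼ` multiply; this is why `∗` becomes the
coefficientwise product. The necklace product becomes pointwise because `gcd(i,j) lcm(i,j) = ij`,
and `g ∘ f = w` is Möbius inversion.

On the side of free probability, the law of a sum or product of free variables is determined because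
alternating centred words span the free algebra. Existence and the transforms come from one model,
the completed full Fock space with creation operators `l` and annihilation operators `l*`. Operators
built from different letters are free. The operator `l* + F(l)` has `R = z F(z)`, and `F(l)(1 + l*)`
has `S = 1/F`, by a telescoping recursion for the moments (`mul_subst_eq_one`). Hence every `R` and
every `S` occurs. For two letters, a suitable generating series of vacuum coefficients reduces the
sum to the same recursion with `F + G`, and the product to the one with `F G`; so `R` is additive
and `S` multiplicative. -/

noncomputable section

namespace FreeWitt

open PowerSeries
open scoped PowerSeries.WithPiTopology

/-! ## Joint distributions of free pairs -/

namespace NCProbSpace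

variable {A B : Type*} [Ring A] [Algebra ℂ A] [Ring B] [Algebra ℂ B]

/-- An alternating word of polynomials in the generators that are centred for the given laws. -/
def IsAlternatingCentred (μ : Fin 2 → Law) (l : List (Fin 2 × Polynomial ℂ)) : Prop :=
  l.IsChain (fun p q => p.1 ≠ q.1) ∧ ∀ p ∈ l, (μ p.1).toLin p.2 = 0

/-- The element of the free algebra given by a word of polynomials in the generators. -/
def wordEval (l : List (Fin 2 × Polynomial ℂ)) : FreeAlgebra ℂ (Fin 2) :=
  (l.map fun p => Polynomial.aeval (FreeAlgebra.ι ℂ p.1) p.2).prod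

/-- The span of the alternating centred words. -/
def alternatingSpan (μ : Fin 2 → Law) : Submodule ℂ (FreeAlgebra ℂ (Fin 2)) :=
  Submodule.span ℂ (wordEval '' {l | IsAlternatingCentred μ l})

/-- Centring: with `m` the mean of `q`, the part `q - m` extends the alternating word by one centred
letter and the scalar `m` leaves the word as it is. -/
theorem aeval_mul_wordEval_mem (μ : Fin 2 → Law) {l : List (Fin 2 × Polynomial ℂ)}
    (hl : IsAlternatingCentred μ l) (i : Fin 2) (hi : ∀ p ∈ l.head?, i ≠ p.1)
    (q : Polynomial ℂ) :
    Polynomial.aeval (FreeAlgebra.ι ℂ i) q * wordEval l ∈ alternatingSpan μ := by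
  set m := (μ i).toLin q with hm
  have h1 : IsAlternatingCentred μ ((i, q - Polynomial.C m) :: l) := by
    refine ⟨?_, ?_⟩
    · rw [List.isChain_cons]
      exact ⟨fun p hp => hi p hp, hl.1⟩
    · intro p hp
      rcases List.mem_cons.1 hp with rfl | hp
      · have : Polynomial.C m = m • (1 : Polynomial ℂ) := by
          rw [Polynomial.smul_eq_C_mul, mul_one]
        change (μ i).toLin (q - Polynomial.C m) = 0
        rw [map_sub, this, map_smul, (μ i).map_one, smul_eq_mul, mul_one, hm, sub_self]
      · exact hl.2 p hp
  have h2 : Polynomial.aeval (FreeAlgebra.ι ℂ i) q * wordEval l =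
      wordEval ((i, q - Polynomial.C m) :: l) + m • wordEval l := by
    simp [wordEval, sub_mul, Algebra.smul_def]
  rw [h2]
  exact add_mem (Submodule.subset_span ⟨_, h1, rfl⟩)
    (Submodule.smul_mem _ _ (Submodule.subset_span ⟨_, hl, rfl⟩))

/-- The span contains 1 (the empty word) and is stable under left multiplication by the generators,
so it is a left ideal containing 1. -/
theorem alternatingSpan_eq_top (μ : Fin 2 → Law) : alternatingSpan μ = ⊤ := by
  have hgen : ∀ i : Fin 2, ∀ x ∈ alternatingSpan μ, FreeAlgebra.ι ℂ i * x ∈ alternatingSpan μ := by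
    intro i x hx
    induction hx using Submodule.span_induction with
    | zero => simp
    | add x y _ _ hx hy => rw [mul_add]; exact add_mem hx hy
    | smul c x _ hx => rw [mul_smul_comm]; exact Submodule.smul_mem _ _ hx
    | mem x hx =>
      obtain ⟨l, hl, rfl⟩ := hx
      cases l with
      | nil => simpa using aeval_mul_wordEval_mem μ hl i (by simp) Polynomial.X
      | cons p l =>
        have hc := List.isChain_cons.1 hl.1
        have hl' : IsAlternatingCentred μ l := ⟨hc.2, fun q hq => hl.2 q (by simp [hq])⟩
        -- A generator equal to the first letter is absorbed into the first polynomial, which need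
        -- no longer be centred; the previous lemma then applies to the tail.
        by_cases hip : i = p.1
        · have h := aeval_mul_wordEval_mem μ hl' i (fun q hq => hip ▸ hc.1 q hq)
            (Polynomial.X * p.2)
          have e : FreeAlgebra.ι ℂ i * wordEval (p :: l) =
              Polynomial.aeval (FreeAlgebra.ι ℂ i) (Polynomial.X * p.2) * wordEval l := by
            simp [wordEval, hip, mul_assoc]
          rwa [e]
        · simpa using aeval_mul_wordEval_mem μ hl i (by simpa using hip) Polynomial.X
  have hmul : ∀ x : FreeAlgebra ℂ (Fin 2), ∀ y ∈ alternatingSpan μ, x * y ∈ alternatingSpan μ := by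
    intro x
    induction x using FreeAlgebra.induction with
    | grade0 r =>
      intro y hy
      rw [← Algebra.smul_def]
      exact Submodule.smul_mem _ _ hy
    | grade1 i => exact hgen i
    | mul a b ha hb => intro y hy; rw [mul_assoc]; exact ha _ (hb _ hy)
    | add a b ha hb => intro y hy; rw [add_mul]; exact add_mem (ha _ hy) (hb _ hy)
  refine eq_top_iff.2 fun x _ => ?_
  have h1 : (1 : FreeAlgebra ℂ (Fin 2)) ∈ alternatingSpan μ :=
    Submodule.subset_span ⟨[], ⟨by simp, by simp⟩, by simp [wordEval]⟩
  simpa using hmul x 1 h1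

theorem FreePair.φ_lift_wordEval {P : NCProbSpace A} {a b : A} (h : P.FreePair a b)
    {l : List (Fin 2 × Polynomial ℂ)}
    (hl : IsAlternatingCentred ![P.law a, P.law b] l) (hne : l ≠ []) :
    P.φ (FreeAlgebra.lift ℂ ![a, b] (wordEval l)) = 0 := by
  have e : FreeAlgebra.lift ℂ ![a, b] (wordEval l) =
      ((l.map fun p => (p.1, Polynomial.aeval (![a, b] p.1) p.2)).map Prod.snd).prod := by
    rw [wordEval, map_list_prod, List.map_map, List.map_map]
    congr 2
    funext p
    simp [← Polynomial.aeval_algHom_apply]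
  rw [e]
  refine h _ (by simpa using hne) ?_ ?_
  · rw [List.isChain_map]
    exact hl.1
  · intro p hp
    obtain ⟨q, hq, rfl⟩ := List.mem_map.1 hp
    refine ⟨Polynomial.aeval_mem_adjoin_singleton ℂ _, ?_⟩
    have h2 := hl.2 q hq
    generalize q.1 = i at h2
    fin_cases i <;> simpa [law] using h2

/-- Both functionals, pulled back to the free algebra, vanish on nonempty alternating centred words
and take the value 1 on the empty one; such words span. -/
theorem FreePair.φ_lift_eq {P : NCProbSpace A} {Q : NCProbSpace B} {a b : A} {a' b' : B}
    (h : P.FreePair a b) (h' : Q.FreePair a' b') (ha : P.law a = Q.law a')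
    (hb : P.law b = Q.law b') (x : FreeAlgebra ℂ (Fin 2)) :
    P.φ (FreeAlgebra.lift ℂ ![a, b] x) = Q.φ (FreeAlgebra.lift ℂ ![a', b'] x) := by
  have hx : x ∈ alternatingSpan ![P.law a, P.law b] := by
    rw [alternatingSpan_eq_top]; trivial
  induction hx using Submodule.span_induction with
  | zero => simp
  | add x y _ _ hx hy => simp [hx, hy]
  | smul c x _ hx => simp [hx]
  | mem x hx =>
    obtain ⟨l, hl, rfl⟩ := hx
    by_cases hne : l = []
    · simp [hne, wordEval, P.map_one, Q.map_one]
    · rw [h.φ_lift_wordEval hl hne, h'.φ_lift_wordEval (ha ▸ hb ▸ hl) hne]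

theorem law_eq_of_forall {P : NCProbSpace A} {Q : NCProbSpace B} {x : A} {y : B}
    (h : ∀ n, P.φ (x ^ n) = Q.φ (y ^ n)) : P.law x = Q.law y := by
  ext n
  simpa [law] using h n

/-- The law of the sum of free random variables depends only on their laws. -/
theorem FreePair.law_add_eq {P : NCProbSpace A} {Q : NCProbSpace B} {a b : A} {a' b' : B}
    (h : P.FreePair a b) (h' : Q.FreePair a' b') (ha : P.law a = Q.law a')
    (hb : P.law b = Q.law b') : P.law (a + b) = Q.law (a' + b') :=
  law_eq_of_forall fun n => by
    have := h.φ_lift_eq h' ha hb ((FreeAlgebra.ι ℂ 0 + FreeAlgebra.ι ℂ 1) ^ n)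
    have e : FreeAlgebra.lift ℂ ![a, b] ((FreeAlgebra.ι ℂ 0 + FreeAlgebra.ι ℂ 1) ^ n) =
        (a + b) ^ n := by simp
    have e' : FreeAlgebra.lift ℂ ![a', b'] ((FreeAlgebra.ι ℂ 0 + FreeAlgebra.ι ℂ 1) ^ n) =
        (a' + b') ^ n := by simp
    rwa [e, e'] at this

/-- The law of the product of free random variables depends only on their laws. -/
theorem FreePair.law_mul_eq {P : NCProbSpace A} {Q : NCProbSpace B} {a b : A} {a' b' : B}
    (h : P.FreePair a b) (h' : Q.FreePair a' b') (ha : P.law a = Q.law a')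
    (hb : P.law b = Q.law b') : P.law (a * b) = Q.law (a' * b') :=
  law_eq_of_forall fun n => by
    have := h.φ_lift_eq h' ha hb ((FreeAlgebra.ι ℂ 0 * FreeAlgebra.ι ℂ 1) ^ n)
    have e : FreeAlgebra.lift ℂ ![a, b] ((FreeAlgebra.ι ℂ 0 * FreeAlgebra.ι ℂ 1) ^ n) =
        (a * b) ^ n := by simp
    have e' : FreeAlgebra.lift ℂ ![a', b'] ((FreeAlgebra.ι ℂ 0 * FreeAlgebra.ι ℂ 1) ^ n) =
        (a' * b') ^ n := by simp
    rwa [e, e'] at this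

end NCProbSpace

/-! ## Division of power series by the variable -/

@[simp]
theorem coeff_divZ (f : PowerSeries ℂ) (n : ℕ) : coeff n (divZ f) = coeff (n + 1) f := by
  simp [divZ]

theorem X_mul_divZ (f : PowerSeries ℂ) : X * divZ f = f - C (constantCoeff f) := by
  ext n
  cases n with
  | zero => simp
  | succ n => simp [coeff_succ_X_mul]

@[simp]
theorem divZ_add (f g : PowerSeries ℂ) : divZ (f + g) = divZ f + divZ g := by
  ext n; simp

theorem divZ_C_mul (c : ℂ) (f : PowerSeries ℂ) : divZ (C c * f) = C c * divZ f := by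
  ext n; simp

@[simp]
theorem divZ_one : divZ 1 = 0 := by
  ext n; simp [coeff_one]

theorem divZ_X_mul (f : PowerSeries ℂ) : divZ (X * f) = f := by
  ext n; simp [coeff_succ_X_mul]

/-- A twisted Leibniz rule: the backward shift is a derivation up to evaluation at 0. It makes
`leftMul` multiplicative. -/
theorem divZ_mul (f g : PowerSeries ℂ) :
    divZ (f * g) = C (constantCoeff f) * divZ g + divZ f * g := by
  apply mul_left_cancel₀ (X_ne_zero (R := ℂ))
  have hf := X_mul_divZ f
  have hg := X_mul_divZ g
  rw [X_mul_divZ, mul_add, mul_left_comm, hg, ← mul_assoc, hf, map_mul, map_mul]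
  ring

/-! ## The Fock space model -/

/-- Formal series in the words on two letters: the completed full Fock space of `ℂ²`. -/
abbrev Fock : Type := List (Fin 2) → ℂ

namespace Fock

/-- The annihilation operator of the letter `i`. -/
def ann (i : Fin 2) : Module.End ℂ Fock where
  toFun f w := f (i :: w)
  map_add' _ _ := rfl
  map_smul' _ _ := rfl

@[simp]
theorem ann_apply (i : Fin 2) (f : Fock) (w : List (Fin 2)) : ann i f w = f (i :: w) := rfl

/-- The coefficient at a word of the product of a power series in the letter `i` and `f`. -/
def leftMulCoeff (i : Fin 2) (f : Fock) : List (Fin 2) → PowerSeries ℂ → ℂ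
  | [], F => constantCoeff F * f []
  | j :: w, F => constantCoeff F * f (j :: w) +
      if j = i then leftMulCoeff i f w (divZ F) else 0

/-- Left multiplication by a power series in the letter `i`. -/
def leftMul (i : Fin 2) (F : PowerSeries ℂ) : Module.End ℂ Fock where
  toFun f w := leftMulCoeff i f w F
  map_add' f g := by
    funext w
    induction w generalizing F with
    | nil => simp [leftMulCoeff, mul_add]
    | cons j w ih =>
      have := ih (divZ F)
      simp only [Pi.add_apply] at this
      by_cases h : j = i <;> simp [leftMulCoeff, mul_add, h, this]
      ring
  map_smul' c f := by
    funext w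
    induction w generalizing F with
    | nil => simp [leftMulCoeff, mul_left_comm]
    | cons j w ih =>
      have := ih (divZ F)
      simp only [Pi.smul_apply] at this
      by_cases h : j = i <;> simp [leftMulCoeff, mul_add, h, this, mul_left_comm]

theorem leftMul_nil (i : Fin 2) (F : PowerSeries ℂ) (f : Fock) :
    leftMul i F f [] = constantCoeff F * f [] := rfl

theorem leftMul_cons (i : Fin 2) (F : PowerSeries ℂ) (f : Fock) (j : Fin 2) (w : List (Fin 2)) :
    leftMul i F f (j :: w) =
      constantCoeff F * f (j :: w) + if j = i then leftMul i (divZ F) f w else 0 := rfl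

theorem leftMul_add (i : Fin 2) (F G : PowerSeries ℂ) :
    leftMul i (F + G) = leftMul i F + leftMul i G := by
  ext f w
  induction w generalizing F G with
  | nil => simp [leftMul_nil, add_mul]
  | cons j w ih =>
    by_cases h : j = i
    · have := ih (divZ F) (divZ G)
      simp only [LinearMap.add_apply, Pi.add_apply] at this
      simp [leftMul_cons, add_mul, h, this]
      ring
    · simp [leftMul_cons, add_mul, h]

theorem leftMul_C_mul (i : Fin 2) (c : ℂ) (F : PowerSeries ℂ) :
    leftMul i (C c * F) = c • leftMul i F := by
  ext f w
  induction w generalizing F with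
  | nil => simp [leftMul_nil, mul_assoc]
  | cons j w ih =>
    have := ih (divZ F)
    simp only [LinearMap.smul_apply, Pi.smul_apply, smul_eq_mul] at this
    by_cases h : j = i <;> simp [leftMul_cons, h, this, mul_add, mul_assoc, divZ_C_mul]

theorem leftMul_mul_apply (i : Fin 2) (F G : PowerSeries ℂ) (f : Fock) :
    leftMul i (F * G) f = leftMul i F (leftMul i G f) := by
  ext w
  induction w generalizing F G with
  | nil => simp [leftMul_nil, mul_assoc]
  | cons j w ih =>
    have := ih (divZ F) G
    by_cases h : j = i
    · simp [leftMul_cons, h, ← this, divZ_mul, leftMul_add, leftMul_C_mul]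
      ring
    · simp [leftMul_cons, h, mul_assoc]

theorem leftMul_one_apply (i : Fin 2) (f : Fock) : leftMul i 1 f = f := by
  have h0 : ∀ w, leftMul i 0 f w = 0 := by
    intro w
    have := leftMul_C_mul i 0 0
    simp only [map_zero, zero_mul, zero_smul] at this
    simp [this]
  ext w
  cases w with
  | nil => simp [leftMul_nil]
  | cons j w => simp [leftMul_cons, h0]

/-- The vacuum vector. -/
def vacuum : Fock := fun w => if w = [] then 1 else 0

/-- The operators on the Fock space with the vacuum expectation. -/
def space : NCProbSpace (Module.End ℂ Fock) where
  φ :=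
    { toFun := fun T => T vacuum []
      map_add' := fun _ _ => rfl
      map_smul' := fun _ _ => rfl }
  map_one := by simp [vacuum]

theorem space_φ (T : Module.End ℂ Fock) : space.φ T = T vacuum [] := rfl

/-- The vectors without words that begin with the letter `i`. -/
def avoiding (i : Fin 2) : Submodule ℂ Fock := LinearMap.ker (ann i)

theorem mem_avoiding {i : Fin 2} {f : Fock} : f ∈ avoiding i ↔ ∀ w, f (i :: w) = 0 := by
  rw [avoiding, LinearMap.mem_ker]
  exact funext_iff

theorem vacuum_mem_avoiding (i : Fin 2) : vacuum ∈ avoiding i :=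
  mem_avoiding.2 fun w => by simp [vacuum]

/-- On the vectors `F f`, where `F` is a power series in the letter `i` and no word of `f` begins
with `i`, the operator `x` acts through an operator `T` on the power series. -/
def ActsThrough (i : Fin 2) (x : Module.End ℂ Fock) (T : Module.End ℂ (PowerSeries ℂ)) : Prop :=
  ∀ f ∈ avoiding i, ∀ s, x (leftMul i s f) = leftMul i (T s) f

theorem ActsThrough.pow {i : Fin 2} {x : Module.End ℂ Fock} {T : Module.End ℂ (PowerSeries ℂ)}
    (h : ActsThrough i x T) (n : ℕ) : ActsThrough i (x ^ n) (T ^ n) := by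
  induction n with
  | zero => intro f _ s; simp
  | succ n ih =>
    intro f hf s
    rw [pow_succ', Module.End.mul_apply, ih f hf, h f hf, pow_succ', Module.End.mul_apply]

theorem ActsThrough.aeval {i : Fin 2} {x : Module.End ℂ Fock} {T : Module.End ℂ (PowerSeries ℂ)}
    (h : ActsThrough i x T) (p : Polynomial ℂ) :
    ActsThrough i (Polynomial.aeval x p) (Polynomial.aeval T p) := by
  induction p using Polynomial.induction_on' with
  | add p q hp hq =>
    intro f hf s
    simp [hp f hf, hq f hf, leftMul_add]
  | monomial n c =>
    intro f hf s
    simp only [Polynomial.aeval_monomial, Module.End.mul_apply, h.pow n f hf,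
      Module.algebraMap_end_apply, PowerSeries.smul_eq_C_mul, leftMul_C_mul, LinearMap.smul_apply]

/-- The vacuum avoids every letter, so the action can be read off at `s = 1`. -/
theorem ActsThrough.φ_eq {i : Fin 2} {x : Module.End ℂ Fock} {T : Module.End ℂ (PowerSeries ℂ)}
    (h : ActsThrough i x T) : space.φ x = constantCoeff (T 1) := by
  have := h vacuum (vacuum_mem_avoiding i) 1
  rw [leftMul_one_apply] at this
  rw [space_φ, this, leftMul_nil]
  simp [vacuum]

theorem leftMul_mem_avoiding {i j : Fin 2} (hij : i ≠ j) {s : PowerSeries ℂ}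
    (hs : constantCoeff s = 0) (f : Fock) : leftMul i s f ∈ avoiding j :=
  mem_avoiding.2 fun w => by simp [leftMul_cons, hs, hij.symm]

/-- Operators that act through power series in different letters are free. -/
theorem freePair_of_actsThrough {x y : Module.End ℂ Fock} {T U : Module.End ℂ (PowerSeries ℂ)}
    (hx : ActsThrough 0 x T) (hy : ActsThrough 1 y U) : space.FreePair x y := by
  have hmem : ∀ (i : Fin 2) (z : Module.End ℂ Fock),
      z ∈ Algebra.adjoin ℂ {![x, y] i} → ∃ V, ActsThrough i z V := by
    intro i z hz
    rw [Algebra.adjoin_singleton_eq_range_aeval] at hz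
    obtain ⟨p, rfl⟩ := hz
    fin_cases i
    · exact ⟨_, hx.aeval p⟩
    · exact ⟨_, hy.aeval p⟩
  intro l hne hc hl
  -- The induction carries more than the vanishing: the product applied to the vacuum avoids every
  -- letter other than the first index. The next operator therefore acts through `V 1`, whose
  -- constant term is its expectation 0, so the result is supported on words beginning with that
  -- operator's letter.
  have key : ∀ l : List (Fin 2 × Module.End ℂ Fock), l.IsChain (fun p q => p.1 ≠ q.1) →
      (∀ p ∈ l, p.2 ∈ Algebra.adjoin ℂ {![x, y] p.1} ∧ space.φ p.2 = 0) →
      (∀ i, (∀ p ∈ l.head?, i ≠ p.1) → (l.map Prod.snd).prod vacuum ∈ avoiding i) ∧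
        (l ≠ [] → (l.map Prod.snd).prod vacuum [] = 0) := by
    intro l
    induction l with
    | nil => intro _ _; simp [vacuum_mem_avoiding]
    | cons p l ih =>
      intro hc hl
      rw [List.isChain_cons] at hc
      have h1 := (ih hc.2 fun q hq => hl q (by simp [hq])).1 p.1 hc.1
      obtain ⟨hp, hφ⟩ := hl p (by simp)
      obtain ⟨V, hV⟩ := hmem _ _ hp
      have h2 := hV _ h1 1
      rw [leftMul_one_apply] at h2
      rw [hV.φ_eq] at hφ
      simp only [List.map_cons, List.prod_cons, Module.End.mul_apply, h2]
      refine ⟨fun i hi => leftMul_mem_avoiding (fun h => hi p (by simp) h.symm) hφ _, fun _ => ?_⟩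
      rw [leftMul_nil, hφ, zero_mul]
  exact (key l hc hl).2 hne

end Fock

/-! ## Substitution of power series -/

theorem X_pow_dvd_pow {h : PowerSeries ℂ} (hh : constantCoeff h = 0) (n : ℕ) :
    X ^ n ∣ h ^ n :=
  pow_dvd_pow_of_dvd (X_dvd_iff.2 hh) n

theorem X_pow_dvd_subst_sub {h : PowerSeries ℂ} (hh : constantCoeff h = 0) (f : PowerSeries ℂ)
    (N : ℕ) : X ^ N ∣ f.subst h - ∑ n ∈ Finset.range N, C (coeff n f) * h ^ n := by
  rw [X_pow_dvd_iff]
  intro e he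
  rw [map_sub, coeff_subst' (HasSubst.of_constantCoeff_zero' hh), map_sum, sub_eq_zero,
    finsum_eq_sum_of_support_subset (s := Finset.range N)]
  · simp
  · intro d hd
    by_contra hd'
    refine hd ?_
    have : coeff e (h ^ d) = 0 :=
      X_pow_dvd_iff.1 (X_pow_dvd_pow hh d) e (by simp at hd'; omega)
    simp [this]

theorem eq_zero_of_forall_X_pow_dvd {f : PowerSeries ℂ} (h : ∀ N, X ^ N ∣ f) : f = 0 := by
  ext n
  simpa using X_pow_dvd_iff.1 (h (n + 1)) n (Nat.lt_succ_self n)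

/-- A recursion that determines the value of a power series at `h`. -/
theorem mul_subst_eq_one {h q : PowerSeries ℂ} {p : ℕ → PowerSeries ℂ} {m : ℕ → ℂ}
    (hh : constantCoeff h = 0) (hp0 : p 0 = 1) (hp : ∀ n, h * p (n + 1) = p n - q * C (m n)) :
    q * (PowerSeries.mk m).subst h = 1 := by
  -- The recursion multiplied by `h ^ n` telescopes; the remainder `h ^ N * p N` is divisible by `X
  -- ^ N`, hence disappears in the limit.
  have hsum : ∀ N, q * ∑ n ∈ Finset.range N, C (m n) * h ^ n = 1 - h ^ N * p N := by
    intro N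
    induction N with
    | zero => simp [hp0]
    | succ N ih =>
      rw [Finset.sum_range_succ, mul_add, ih]
      linear_combination h ^ N * hp N
  rw [← sub_eq_zero]
  refine eq_zero_of_forall_X_pow_dvd fun N => ?_
  have h1 := X_pow_dvd_subst_sub hh (PowerSeries.mk m) N
  simp only [coeff_mk] at h1
  have h2 : q * (PowerSeries.mk m).subst h - 1 = q * ((PowerSeries.mk m).subst h -
      ∑ n ∈ Finset.range N, C (m n) * h ^ n) - h ^ N * p N := by
    rw [mul_sub, hsum]
    ring
  rw [h2]
  exact dvd_sub (h1.mul_left q) ((X_pow_dvd_pow hh N).mul_right _)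

/-! ### Uniqueness of compositional inverses -/

theorem eq_substInvOfIsUnit {P h : PowerSeries ℂ} (hP : constantCoeff P = 0)
    (hu : IsUnit (coeff 1 P)) (hh : constantCoeff h = 0) (h1 : P.subst h = (X : PowerSeries ℂ)) :
    P.substInvOfIsUnit hu = h := by
  have hP' : HasSubst P := HasSubst.of_constantCoeff_zero' hP
  have hh' : HasSubst h := HasSubst.of_constantCoeff_zero' hh
  have h2 := subst_comp_subst_apply hP' hh' (P.substInvOfIsUnit hu)
  rw [subst_substInvOfIsUnit_left _ hP, subst_X hh', h1, X_subst] at h2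
  exact h2.symm

/-- The composite `Q ∘ P⁻¹ ∘ P` equals `Q`, and, since `P⁻¹ = Q⁻¹`, also `P`. -/
theorem eq_of_substInvOfIsUnit_eq {P Q : PowerSeries ℂ} (hP : constantCoeff P = 0)
    (hQ : constantCoeff Q = 0) (hu : IsUnit (coeff 1 P)) (hv : IsUnit (coeff 1 Q))
    (h : P.substInvOfIsUnit hu = Q.substInvOfIsUnit hv) : P = Q := by
  have hP' : HasSubst P := HasSubst.of_constantCoeff_zero' hP
  have hh' : HasSubst (P.substInvOfIsUnit hu) := HasSubst.substInvOfIsUnit _ _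
  have h2 := subst_comp_subst_apply hh' hP' Q
  rw [subst_substInvOfIsUnit_left _ hP, X_subst, h, subst_substInvOfIsUnit_right _ hQ,
    subst_X hP'] at h2
  exact h2

/-! ## Computation and injectivity of the transforms -/

theorem constantCoeff_cauchySeries (μ : Law) : constantCoeff (cauchySeries μ) = 0 := by
  simp [cauchySeries]

theorem constantCoeff_momentSeries (μ : Law) : constantCoeff (momentSeries μ) = 0 := by
  rw [← coeff_zero_eq_constantCoeff_apply]
  simp [momentSeries]

theorem momentSeries_eq (μ : Law) : momentSeries μ = PowerSeries.mk μ.moment - 1 := by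
  ext n
  cases n with
  | zero => simp [momentSeries, Law.moment, μ.map_one]
  | succ n => simp [momentSeries, coeff_one]

theorem eq_of_divZ_eq {f g : PowerSeries ℂ} (hf : constantCoeff f = 0) (hg : constantCoeff g = 0)
    (h : divZ f = divZ g) : f = g := by
  have h1 := X_mul_divZ f
  have h2 := X_mul_divZ g
  rw [hf, map_zero, sub_zero] at h1
  rw [hg, map_zero, sub_zero] at h2
  rw [← h1, ← h2, h]

theorem Law.ext_moment {μ ν : Law} (h : ∀ n, μ.moment n = ν.moment n) : μ = ν := by
  ext n
  simpa [Law.moment, Polynomial.X_pow_eq_monomial] using h n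

theorem rTransform_injective : Function.Injective rTransform := by
  intro μ ν h
  have h1 : (divZ (cauchyInv μ))⁻¹ = (divZ (cauchyInv ν))⁻¹ := by
    have := congrArg ZSeries.series h
    simpa [rTransform] using this
  -- With vanishing constant term the inverse would have constant term `0⁻¹ = 0`, and `R` would have
  -- constant term -1.
  have hc : ∀ ρ : Law, constantCoeff (divZ (cauchyInv ρ)) ≠ 0 := by
    intro ρ h0
    have := (rTransform ρ).const
    simp [rTransform, PowerSeries.constantCoeff_inv, h0] at this
  have h2 : divZ (cauchyInv μ) = divZ (cauchyInv ν) := by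
    have e1 := PowerSeries.mul_inv_cancel _ (hc μ)
    have e2 := PowerSeries.mul_inv_cancel _ (hc ν)
    rw [h1] at e1
    calc divZ (cauchyInv μ) = divZ (cauchyInv μ) * (divZ (cauchyInv ν) *
          (divZ (cauchyInv ν))⁻¹) := by rw [e2, mul_one]
      _ = divZ (cauchyInv ν) * (divZ (cauchyInv μ) * (divZ (cauchyInv ν))⁻¹) := by ring
      _ = divZ (cauchyInv ν) := by rw [e1, mul_one]
  have h3 : cauchyInv μ = cauchyInv ν :=
    eq_of_divZ_eq (constantCoeff_substInvOfIsUnit _ _) (constantCoeff_substInvOfIsUnit _ _) h2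
  have h4 := eq_of_substInvOfIsUnit_eq (constantCoeff_cauchySeries μ)
    (constantCoeff_cauchySeries ν) _ _ h3
  refine Law.ext_moment fun n => ?_
  have := congrArg (coeff (n + 1)) h4
  simpa [cauchySeries, coeff_succ_X_mul] using this

theorem sTransform_injective : Function.Injective sTransform := by
  intro μ ν h
  have h1 : (1 + X) * divZ (momentInv μ) = (1 + X) * divZ (momentInv ν) :=
    congrArg Lambda.series h
  have hX : (1 + X : PowerSeries ℂ) ≠ 0 := by
    intro h0
    have := congrArg constantCoeff h0
    simp at this
  have h3 : momentInv μ = momentInv ν :=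
    eq_of_divZ_eq (constantCoeff_substInvOfIsUnit _ _) (constantCoeff_substInvOfIsUnit _ _)
      (mul_left_cancel₀ hX h1)
  have h4 := eq_of_substInvOfIsUnit_eq (constantCoeff_momentSeries _)
    (constantCoeff_momentSeries _) _ _ h3
  have h5 : μ.toLaw = ν.toLaw := by
    refine Law.ext_moment fun n => ?_
    rw [momentSeries_eq, momentSeries_eq, sub_left_inj] at h4
    simpa using congrArg (coeff n) h4
  cases μ
  cases ν
  cases h5
  rfl

/-- The `R`-transform of a law whose moments satisfy the recursion of the operator
`l* + F (l)`. -/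
theorem rTransform_series_of_recursion {μ : Law} {F : PowerSeries ℂ} {p : ℕ → PowerSeries ℂ}
    (hp0 : p 0 = 1) (hp : ∀ n, p (n + 1) = divZ (p n) + F * p n)
    (hm : ∀ n, constantCoeff (p n) = μ.moment n) : (rTransform μ).series = X * F := by
  set u : PowerSeries ℂ := 1 + X * F with hu
  have hu0 : constantCoeff u = 1 := by simp [hu]
  have huq : u * u⁻¹ = 1 := PowerSeries.mul_inv_cancel _ (by simp [hu0])
  have hh : constantCoeff (X * u⁻¹) = 0 := by simp
  -- The recursion says `X p (n+1) = u p n - m n` for `u = 1 + X F`; dividing by `u` gives the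
  -- telescoping form with `h = X / u`, which is thus the inverse of the Cauchy series.
  have key : u⁻¹ * (PowerSeries.mk μ.moment).subst (X * u⁻¹) = 1 := by
    refine mul_subst_eq_one hh hp0 fun n => ?_
    have h1 := X_mul_divZ (p n)
    rw [hm] at h1
    rw [hp]
    linear_combination u⁻¹ * h1 + p n * huq - u⁻¹ * p n * hu
  have h2 : (cauchySeries μ).subst (X * u⁻¹) = (X : PowerSeries ℂ) := by
    have hs : HasSubst (X * u⁻¹ : PowerSeries ℂ) := HasSubst.of_constantCoeff_zero' hh
    rw [cauchySeries, subst_mul hs, subst_X hs, mul_assoc, key, mul_one]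
  have h3 : cauchyInv μ = X * u⁻¹ :=
    eq_substInvOfIsUnit (constantCoeff_cauchySeries μ) _ hh h2
  change (divZ (cauchyInv μ))⁻¹ - 1 = X * F
  rw [h3, divZ_X_mul]
  have h4 : u⁻¹⁻¹ = u := by
    rw [PowerSeries.inv_eq_iff_mul_eq_one (by simp [PowerSeries.constantCoeff_inv, hu0]), huq]
  rw [h4, hu]
  ring

/-- The `S`-transform of a law whose moments satisfy the recursion of the operator
`F (l) (1 + l*)`. -/
theorem sTransform_series_mul_of_recursion {μ : LawOne} {F : PowerSeries ℂ}
    {p : ℕ → PowerSeries ℂ} (hF : constantCoeff F = 1) (hp0 : p 0 = 1)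
    (hp : ∀ n, p (n + 1) = F * (p n + divZ (p n)))
    (hm : ∀ n, constantCoeff (p n) = μ.moment n) : (sTransform μ).series * F = 1 := by
  set q : PowerSeries ℂ := (1 + X)⁻¹ with hq
  have hq1 : (1 + X) * q = 1 := PowerSeries.mul_inv_cancel _ (by simp)
  have hF1 : F * F⁻¹ = 1 := PowerSeries.mul_inv_cancel _ (by simp [hF])
  have hh : constantCoeff (X * (F⁻¹ * q)) = 0 := by simp
  have hs : HasSubst (X * (F⁻¹ * q) : PowerSeries ℂ) := HasSubst.of_constantCoeff_zero' hh
  -- Here `X p (n+1) = F ((1 + X) p n - m n)`, so dividing by `F (1 + X)` gives the telescoping form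
  -- with `h = X / (F (1 + X))`.
  have key : q * (PowerSeries.mk μ.moment).subst (X * (F⁻¹ * q)) = 1 := by
    refine mul_subst_eq_one hh hp0 fun n => ?_
    have h1 := X_mul_divZ (p n)
    rw [hm] at h1
    rw [hp]
    linear_combination q * F * F⁻¹ * h1 + (p n * (1 + X) * q - q * C (μ.moment n)) * hF1 +
      p n * hq1
  have h1 : (momentSeries μ.toLaw).subst (X * (F⁻¹ * q)) = (X : PowerSeries ℂ) := by
    have e : (PowerSeries.mk μ.moment).subst (X * (F⁻¹ * q)) = (1 + X : PowerSeries ℂ) := by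
      linear_combination (1 + X) * key -
        (PowerSeries.mk μ.moment).subst (X * (F⁻¹ * q)) * hq1
    rw [momentSeries_eq, subst_sub hs, e, ← coe_substAlgHom hs, map_one]
    ring
  have h3 : momentInv μ = X * (F⁻¹ * q) :=
    eq_substInvOfIsUnit (constantCoeff_momentSeries _) _ hh h1
  change (1 + X) * divZ (momentInv μ) * F = 1
  rw [h3, divZ_X_mul]
  linear_combination F * F⁻¹ * hq1 + hF1

/-! ## Canonical operators on the Fock space -/

namespace Fock

theorem ann_leftMul {i : Fin 2} {f : Fock} (hf : f ∈ avoiding i) (s : PowerSeries ℂ) :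
    ann i (leftMul i s f) = leftMul i (divZ s) f := by
  funext w
  simp [leftMul_cons, mem_avoiding.1 hf w]

/-- `l* + F (l)` for the letter `i`. -/
def addModel (i : Fin 2) (F : PowerSeries ℂ) : Module.End ℂ Fock := ann i + leftMul i F

/-- `F (l) (1 + l*)` for the letter `i`. -/
def mulModel (i : Fin 2) (F : PowerSeries ℂ) : Module.End ℂ Fock := leftMul i F * (1 + ann i)

/-- `divZ` as a linear map. -/
def divZLin : Module.End ℂ (PowerSeries ℂ) where
  toFun := divZ
  map_add' := divZ_add
  map_smul' c f := by ext n; simp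

@[simp] theorem divZLin_apply (s : PowerSeries ℂ) : divZLin s = divZ s := rfl

theorem addModel_actsThrough (i : Fin 2) (F : PowerSeries ℂ) :
    ActsThrough i (addModel i F) (divZLin + LinearMap.mulLeft ℂ F) := by
  intro f hf s
  simp [addModel, ann_leftMul hf, leftMul_add, leftMul_mul_apply]

theorem mulModel_actsThrough (i : Fin 2) (F : PowerSeries ℂ) :
    ActsThrough i (mulModel i F) (LinearMap.mulLeft ℂ F * (1 + divZLin)) := by
  intro f hf s
  simp [mulModel, ann_leftMul hf, leftMul_add, leftMul_mul_apply, mul_add]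

theorem freePair_addModel (F G : PowerSeries ℂ) :
    space.FreePair (addModel 0 F) (addModel 1 G) :=
  freePair_of_actsThrough (addModel_actsThrough 0 F) (addModel_actsThrough 1 G)

theorem freePair_mulModel (F G : PowerSeries ℂ) :
    space.FreePair (mulModel 0 F) (mulModel 1 G) :=
  freePair_of_actsThrough (mulModel_actsThrough 0 F) (mulModel_actsThrough 1 G)

theorem moment_law (x : Module.End ℂ Fock) (n : ℕ) :
    (space.law x).moment n = space.φ (x ^ n) := by
  simp [Law.moment, NCProbSpace.law]

theorem rTransform_addModel (i : Fin 2) (F : PowerSeries ℂ) :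
    (rTransform (space.law (addModel i F))).series = X * F := by
  refine rTransform_series_of_recursion
    (p := fun n => ((divZLin + LinearMap.mulLeft ℂ F) ^ n) 1) (by simp) (fun n => ?_) fun n => ?_
  · simp [pow_succ']
  · rw [moment_law, ((addModel_actsThrough i F).pow n).φ_eq]

/-- A law of mean one with prescribed underlying law. -/
def lawOneOf (x : Module.End ℂ Fock) (h : space.φ x = 1) : LawOne where
  toLaw := space.law x
  mean := by simpa [NCProbSpace.law] using h

theorem φ_mulModel (i : Fin 2) {F : PowerSeries ℂ} (hF : constantCoeff F = 1) :
    space.φ (mulModel i F) = 1 := by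
  rw [(mulModel_actsThrough i F).φ_eq]
  simp [hF]

theorem sTransform_mulModel (i : Fin 2) {F : PowerSeries ℂ} (hF : constantCoeff F = 1) :
    (sTransform (lawOneOf _ (φ_mulModel i hF))).series * F = 1 := by
  refine sTransform_series_mul_of_recursion
    (p := fun n => ((LinearMap.mulLeft ℂ F * (1 + divZLin)) ^ n) 1) hF (by simp) (fun n => ?_)
      fun n => ?_
  · simp [pow_succ']
  · change _ = (space.law _).moment n
    rw [moment_law, ((mulModel_actsThrough i F).pow n).φ_eq]

/-! ### Sums and products of canonical operators -/

/-- The generating series of the vacuum coefficients of `D ^ n f`. -/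
def genSeries (D : Module.End ℂ Fock) : Fock →ₗ[ℂ] PowerSeries ℂ where
  toFun f := PowerSeries.mk fun n => (D ^ n) f []
  map_add' f g := by ext n; simp
  map_smul' c f := by ext n; simp

theorem constantCoeff_genSeries (D : Module.End ℂ Fock) (f : Fock) :
    constantCoeff (genSeries D f) = f [] := by
  rw [← coeff_zero_eq_constantCoeff_apply]
  simp [genSeries]

/-- The generating series intertwines `D` with the backward shift, so a sum of annihilators becomes
`divZ`. -/
theorem divZ_genSeries (D : Module.End ℂ Fock) (f : Fock) :
    divZ (genSeries D f) = genSeries D (D f) := by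
  ext n
  simp [genSeries, pow_succ]

/-- The creation operator of the letter `i`. -/
def create (i : Fin 2) (f : Fock) : Fock
  | [] => 0
  | j :: w => if j = i then f w else 0

theorem ann_create_self (i : Fin 2) (f : Fock) : ann i (create i f) = f := by
  funext w; simp [create]

theorem ann_create_of_ne {i j : Fin 2} (h : j ≠ i) (f : Fock) : ann j (create i f) = 0 := by
  funext w; simp [create, h]

theorem leftMul_eq_create (i : Fin 2) (F : PowerSeries ℂ) (f : Fock) :
    leftMul i F f = constantCoeff F • f + create i (leftMul i (divZ F) f) := by
  funext w
  cases w with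
  | nil => simp [leftMul_nil, create]
  | cons j w => simp [leftMul_cons, create]

/-- A map that turns creation into multiplication by the variable turns multiplication by power
series in the letter into multiplication by power series. -/
theorem map_leftMul {i : Fin 2} {N : Fock →ₗ[ℂ] PowerSeries ℂ}
    (hN : ∀ f, N (create i f) = X * N f) (F : PowerSeries ℂ) (f : Fock) :
    N (leftMul i F f) = F * N f := by
  have hF : ∀ F : PowerSeries ℂ, F = C (constantCoeff F) + X * divZ F := fun F => by
    rw [X_mul_divZ]; ring
  ext n
  induction n generalizing F with
  | zero =>
    rw [leftMul_eq_create, map_add, hN]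
    simp
  | succ n ih =>
    have e : F * N f = constantCoeff F • N f + X * (divZ F * N f) := by
      rw [PowerSeries.smul_eq_C_mul]
      nth_rewrite 1 [hF F]
      ring
    rw [leftMul_eq_create, map_add, hN, e, map_smul, map_add, map_add, coeff_succ_X_mul,
      coeff_succ_X_mul, ih]

theorem genSeries_vacuum (D : Module.End ℂ Fock) (hD : D vacuum = 0) :
    genSeries D vacuum = 1 := by
  have h := X_mul_divZ (genSeries D vacuum)
  rw [divZ_genSeries, hD, map_zero, mul_zero, constantCoeff_genSeries] at h
  simpa [vacuum] using (sub_eq_zero.1 h.symm)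

theorem ann_vacuum (i : Fin 2) : ann i vacuum = 0 := by
  funext w; simp [vacuum]

/-- A created vector has no vacuum component, so its generating series is determined by its shift.
-/
theorem genSeries_create {D : Module.End ℂ Fock} {i : Fin 2} {f g : Fock}
    (h : D (create i f) = g) : genSeries D (create i f) = X * genSeries D g := by
  have h1 := X_mul_divZ (genSeries D (create i f))
  rw [divZ_genSeries, constantCoeff_genSeries, h] at h1
  simpa [create] using h1.symm

/-- `D = ann 0 + ann 1` is a left inverse of both creation operators, so `genSeries D` sends either
letter to the variable and `a + b` to `divZ + (F + G)`, the recursion of a single letter. -/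
theorem rTransform_add_addModel (F G : PowerSeries ℂ) :
    (rTransform (space.law (addModel 0 F + addModel 1 G))).series = X * (F + G) := by
  set D : Module.End ℂ Fock := ann 0 + ann 1 with hD
  have h0 : ∀ f, genSeries D (create 0 f) = X * genSeries D f := fun f =>
    genSeries_create (by
      simp [hD, ann_create_self, ann_create_of_ne (show (1 : Fin 2) ≠ 0 by decide)])
  have h1 : ∀ f, genSeries D (create 1 f) = X * genSeries D f := fun f =>
    genSeries_create (by
      simp [hD, ann_create_self, ann_create_of_ne (show (0 : Fin 2) ≠ 1 by decide)])
  refine rTransform_series_of_recursion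
    (p := fun n => genSeries D (((addModel 0 F + addModel 1 G) ^ n) vacuum)) ?_ (fun n => ?_)
      fun n => ?_
  · exact genSeries_vacuum D (by simp [hD, ann_vacuum])
  · rw [pow_succ', Module.End.mul_apply]
    generalize ((addModel 0 F + addModel 1 G) ^ n) vacuum = f
    rw [divZ_genSeries, add_mul, ← map_leftMul h0, ← map_leftMul h1, ← map_add, ← map_add]
    congr 1
    simp only [addModel, hD, LinearMap.add_apply]
    abel
  · rw [constantCoeff_genSeries, moment_law, space_φ]

/-- The recursion for the product of the canonical multiplicative operators. -/
theorem genSeries_mulModel (F G : PowerSeries ℂ) (f : Fock) :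
    genSeries ((1 + ann 0) * (1 + ann 1) - 1) ((mulModel 0 F * mulModel 1 G) f) =
      F * G * (genSeries ((1 + ann 0) * (1 + ann 1) - 1) f +
        divZ (genSeries ((1 + ann 0) * (1 + ann 1) - 1) f)) := by
  -- Chosen so that `1 + D` is what remains of the product once both left multiplications have been
  -- pulled out.
  set D : Module.End ℂ Fock := (1 + ann 0) * (1 + ann 1) - 1 with hD
  have h0 : ∀ f, genSeries D (create 0 f) = X * genSeries D f := fun f =>
    genSeries_create (by
      simp [hD, ann_create_self, ann_create_of_ne (show (1 : Fin 2) ≠ 0 by decide)])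
  -- The factor `1 + ann 0` stands to the left of `leftMul 1 G`. It fixes `create 1 f`, while `D
  -- (create 1 f) = (1 + ann 0) f`; so the composite, rather than `genSeries D`, intertwines the
  -- creation of the letter 1.
  have h1 : ∀ f, (genSeries D ∘ₗ (1 + ann 0)) (create 1 f) =
      X * (genSeries D ∘ₗ (1 + ann 0)) f := fun f => by
    have e : (1 + ann 0) (create 1 f) = create 1 f := by
      simp [ann_create_of_ne (show (0 : Fin 2) ≠ 1 by decide)]
    rw [LinearMap.comp_apply, e, LinearMap.comp_apply]
    refine genSeries_create ?_
    simp only [hD, ann_create_self, ann_create_of_ne (show (0 : Fin 2) ≠ 1 by decide),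
      LinearMap.sub_apply, Module.End.mul_apply, LinearMap.add_apply, Module.End.one_apply, map_add]
    abel
  have e : (mulModel 0 F * mulModel 1 G) f =
      leftMul 0 F ((1 + ann 0) (leftMul 1 G ((1 + ann 1) f))) := rfl
  rw [e, map_leftMul h0, ← LinearMap.comp_apply (genSeries D), map_leftMul h1, divZ_genSeries,
    ← map_add, mul_assoc, LinearMap.comp_apply]
  have e2 : (1 + ann 0) ((1 + ann 1) f) = f + D f := by simp [hD]
  rw [e2]

theorem φ_mul_mulModel {F G : PowerSeries ℂ} (hF : constantCoeff F = 1)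
    (hG : constantCoeff G = 1) : space.φ (mulModel 0 F * mulModel 1 G) = 1 := by
  rw [space_φ, ← constantCoeff_genSeries ((1 + ann 0) * (1 + ann 1) - 1)
    ((mulModel 0 F * mulModel 1 G) vacuum), genSeries_mulModel,
    genSeries_vacuum _ (by simp [ann_vacuum])]
  simp [hF, hG]

theorem sTransform_mul_mulModel {F G : PowerSeries ℂ} (hF : constantCoeff F = 1)
    (hG : constantCoeff G = 1) :
    (sTransform (lawOneOf _ (φ_mul_mulModel hF hG))).series * (F * G) = 1 := by
  refine sTransform_series_mul_of_recursion
    (p := fun n => genSeries ((1 + ann 0) * (1 + ann 1) - 1)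
      (((mulModel 0 F * mulModel 1 G) ^ n) vacuum)) (by simp [hF, hG]) ?_ (fun n => ?_)
      fun n => ?_
  · exact genSeries_vacuum _ (by simp [ann_vacuum])
  · rw [pow_succ', Module.End.mul_apply, genSeries_mulModel]
  · rw [constantCoeff_genSeries]
    exact (moment_law _ n).symm

end Fock

/-! ## The transforms are bijective and additive -/

theorem ZSeries.X_mul_divZ_series (r : ZSeries) : X * divZ r.series = r.series := by
  rw [X_mul_divZ, r.const, map_zero, sub_zero]

theorem rTransform_law_addModel (i : Fin 2) (r : ZSeries) :
    rTransform (Fock.space.law (Fock.addModel i (divZ r.series))) = r :=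
  ZSeries.ext (by rw [Fock.rTransform_addModel, r.X_mul_divZ_series])

theorem rTransform_bijective : Function.Bijective rTransform :=
  ⟨rTransform_injective, fun r => ⟨_, rTransform_law_addModel 0 r⟩⟩

theorem law_addModel (i : Fin 2) (μ : Law) :
    Fock.space.law (Fock.addModel i (divZ (rTransform μ).series)) = μ :=
  rTransform_injective (rTransform_law_addModel i _)

/-- The Fock model supplies a free pair with the given laws, so the choice in `freeAddConv` is among
actual convolutions. -/
theorem isFreeAddConv_add (μ ν : Law) : IsFreeAddConv μ ν (μ + ν) :=
  Classical.epsilon_spec (p := fun ρ => IsFreeAddConv μ ν ρ)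
    ⟨_, _, _, _, Fock.space, _, _, Fock.freePair_addModel _ _, law_addModel 0 μ,
      law_addModel 1 ν, rfl⟩

theorem law_add_of_freePair {A : Type*} [Ring A] [Algebra ℂ A] (P : NCProbSpace A) (a b : A)
    (h : P.FreePair a b) : P.law (a + b) = P.law a + P.law b := by
  obtain ⟨B, _, _, Q, a', b', h', ha, hb, hab⟩ := isFreeAddConv_add (P.law a) (P.law b)
  rw [← hab]
  exact h.law_add_eq h' ha.symm hb.symm

theorem rTransform_add (μ ν : Law) :
    rTransform (μ + ν) = rTransform μ + rTransform ν := by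
  have h := law_add_of_freePair _ _ _
    (Fock.freePair_addModel (divZ (rTransform μ).series) (divZ (rTransform ν).series))
  rw [law_addModel, law_addModel] at h
  rw [← h]
  refine ZSeries.ext ?_
  rw [Fock.rTransform_add_addModel, mul_add, ZSeries.X_mul_divZ_series,
    ZSeries.X_mul_divZ_series]
  rfl

theorem Lambda.mul_inv_series (s : Lambda) : s.series * s.series⁻¹ = 1 :=
  PowerSeries.mul_inv_cancel _ (by simp [s.const])

theorem Lambda.constantCoeff_inv_series (s : Lambda) : constantCoeff s.series⁻¹ = 1 := by
  simp [PowerSeries.constantCoeff_inv, s.const]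

theorem sTransform_law_mulModel (i : Fin 2) (s : Lambda) :
    sTransform (Fock.lawOneOf _ (Fock.φ_mulModel i s.constantCoeff_inv_series)) = s := by
  have h := Fock.sTransform_mulModel i s.constantCoeff_inv_series
  refine Lambda.ext ?_
  linear_combination s.series * h -
    (sTransform (Fock.lawOneOf _ (Fock.φ_mulModel i s.constantCoeff_inv_series))).series *
      s.mul_inv_series

theorem sTransform_bijective : Function.Bijective sTransform :=
  ⟨sTransform_injective, fun s => ⟨_, sTransform_law_mulModel 0 s⟩⟩

theorem law_mulModel (i : Fin 2) (μ : LawOne) :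
    Fock.space.law (Fock.mulModel i (sTransform μ).series⁻¹) = μ.toLaw :=
  congrArg LawOne.toLaw (sTransform_injective (sTransform_law_mulModel i (sTransform μ)))

/-- The choice here ranges over laws of mean one, so the witness also needs `φ (a b) = 1` in the
Fock model. -/
theorem isFreeMulConv_add (μ ν : LawOne) : IsFreeMulConv μ.toLaw ν.toLaw (μ + ν).toLaw :=
  Classical.epsilon_spec (p := fun ρ : LawOne => IsFreeMulConv μ.toLaw ν.toLaw ρ.toLaw)
    ⟨Fock.lawOneOf _ (Fock.φ_mul_mulModel (sTransform μ).constantCoeff_inv_series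
      (sTransform ν).constantCoeff_inv_series),
      _, _, _, Fock.space, _, _, Fock.freePair_mulModel _ _, law_mulModel 0 μ,
      law_mulModel 1 ν, rfl⟩

theorem law_mul_of_freePair {A : Type*} [Ring A] [Algebra ℂ A] (P : NCProbSpace A) (a b : A)
    (μ ν : LawOne) (h : P.FreePair a b) (ha : P.law a = μ.toLaw) (hb : P.law b = ν.toLaw) :
    P.law (a * b) = (μ + ν).toLaw := by
  obtain ⟨B, _, _, Q, a', b', h', ha', hb', hab⟩ := isFreeMulConv_add μ ν
  rw [← hab]
  exact h.law_mul_eq h' (ha.trans ha'.symm) (hb.trans hb'.symm)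

theorem LawOne.toLaw_injective : Function.Injective LawOne.toLaw := by
  rintro ⟨μ, _⟩ ⟨ν, _⟩ rfl
  rfl

theorem sTransform_add (μ ν : LawOne) :
    sTransform (μ + ν) = sTransform μ + sTransform ν := by
  have hμ := (sTransform μ).constantCoeff_inv_series
  have hν := (sTransform ν).constantCoeff_inv_series
  have h : Fock.lawOneOf _ (Fock.φ_mul_mulModel hμ hν) = μ + ν :=
    LawOne.toLaw_injective (law_mul_of_freePair _ _ _ μ ν (Fock.freePair_mulModel _ _)
      (law_mulModel 0 μ) (law_mulModel 1 ν))
  have h2 := Fock.sTransform_mul_mulModel hμ hν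
  rw [h] at h2
  refine Lambda.ext ?_
  change _ = (sTransform μ).series * (sTransform ν).series
  linear_combination (sTransform μ).series * (sTransform ν).series * h2 -
    (sTransform (μ + ν)).series * (sTransform ν).series * (sTransform ν).series⁻¹ *
      (sTransform μ).mul_inv_series - (sTransform (μ + ν)).series * (sTransform ν).mul_inv_series

/-! ## Logarithmic derivatives -/

/-- `F` is the logarithmic derivative `z f' / f`. -/
def IsLogDeriv (F f : PowerSeries ℂ) : Prop := F * f = X * PowerSeries.derivative ℂ f

theorem isLogDeriv_zdlog (f : Lambda) : IsLogDeriv (zdlog f).series f.series := by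
  have hs : HasSubst (f.series - 1) := HasSubst.of_constantCoeff_zero' (by simp [f.const])
  -- The identity `(1 + X) log' = 1`, evaluated at `f - 1`, becomes `f · (log' at f - 1) = 1`; the
  -- chain rule does the rest.
  have h1 : (1 + X) * PowerSeries.derivative ℂ (PowerSeries.log ℂ) = 1 := by
    ext n
    rw [PowerSeries.deriv_log, add_mul, one_mul]
    cases n with
    | zero => simp
    | succ n => simp [coeff_succ_X_mul, pow_succ, coeff_one]
  have h2 := congrArg (PowerSeries.subst (f.series - 1)) h1
  rw [subst_mul hs, subst_add hs, subst_X hs, ← coe_substAlgHom hs, map_one, coe_substAlgHom hs,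
    add_sub_cancel] at h2
  change X * PowerSeries.derivative ℂ (PowerSeries.logOf f.series) * f.series = _
  rw [PowerSeries.logOf_eq, PowerSeries.derivative_subst hs, map_sub,
    PowerSeries.derivative_one, sub_zero]
  linear_combination X * PowerSeries.derivative ℂ f.series * h2

namespace IsLogDeriv

theorem one : IsLogDeriv 0 1 := by simp [IsLogDeriv]

theorem mul {F G f g : PowerSeries ℂ} (hf : IsLogDeriv F f) (hg : IsLogDeriv G g) :
    IsLogDeriv (F + G) (f * g) := by
  unfold IsLogDeriv at *
  rw [Derivation.leibniz, smul_eq_mul, smul_eq_mul]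
  linear_combination g * hf + f * hg

theorem finset_prod {ι : Type*} (s : Finset ι) {F f : ι → PowerSeries ℂ}
    (h : ∀ i ∈ s, IsLogDeriv (F i) (f i)) : IsLogDeriv (∑ i ∈ s, F i) (∏ i ∈ s, f i) := by
  classical
  induction s using Finset.induction_on with
  | empty => simpa using one
  | insert i s hi ih =>
    rw [Finset.sum_insert hi, Finset.prod_insert hi]
    exact (h i (by simp)).mul (ih fun j hj => h j (by simp [hj]))

theorem multiset_prod {ι : Type*} (s : Multiset ι) {F f : ι → PowerSeries ℂ}
    (h : ∀ i, IsLogDeriv (F i) (f i)) : IsLogDeriv (s.map F).sum (s.map f).prod := by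
  induction s using Multiset.induction_on with
  | empty => simpa using one
  | cons i s ih => simpa using (h i).mul ih

theorem constantCoeff_eq_zero {F f : PowerSeries ℂ} (h : IsLogDeriv F f)
    (hf : constantCoeff f = 1) : constantCoeff F = 0 := by
  have := congrArg constantCoeff h
  simpa [hf] using this

/-- Newton's recursion: the coefficient of order `n + 1` of `f` depends on lower ones of `f` and on
those of `F` up to `n + 1`. -/
theorem coeff_succ {F f : PowerSeries ℂ} (h : IsLogDeriv F f) (hf : constantCoeff f = 1) (n : ℕ) :
    ((n : ℂ) + 1) * coeff (n + 1) f =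
      ∑ p ∈ Finset.HasAntidiagonal.antidiagonal n, coeff (p.1 + 1) F * coeff p.2 f := by
  have h0 := h.constantCoeff_eq_zero hf
  have := congrArg (coeff (n + 1)) h
  rw [coeff_mul, Finset.Nat.sum_antidiagonal_succ, coeff_succ_X_mul, coeff_derivative] at this
  simp only [coeff_zero_eq_constantCoeff_apply, h0, zero_mul, zero_add] at this
  rw [this, mul_comm]

/-- Power series with constant coefficient one agree up to some order if their logarithmic
derivatives do. -/
theorem coeff_eq {F G f g : PowerSeries ℂ} (hF : IsLogDeriv F f) (hG : IsLogDeriv G g)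
    (hf : constantCoeff f = 1) (hg : constantCoeff g = 1) {N : ℕ}
    (h : ∀ k ≤ N, coeff k F = coeff k G) : ∀ k ≤ N, coeff k f = coeff k g := by
  intro k
  induction k using Nat.strong_induction_on with
  | _ k ih =>
    intro hk
    cases k with
    | zero => simp [hf, hg]
    | succ n =>
      have hn : ((n : ℂ) + 1) ≠ 0 := by exact_mod_cast Nat.succ_ne_zero n
      apply mul_left_cancel₀ hn
      rw [hF.coeff_succ hf, hG.coeff_succ hg]
      refine Finset.sum_congr rfl fun p hp => ?_
      have := Finset.HasAntidiagonal.mem_antidiagonal.1 hp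
      rw [h _ (by omega), ih p.2 (by omega) (by omega)]

/-- The logarithmic derivatives agree up to some order if the power series do. -/
theorem coeff_eq' {F G f g : PowerSeries ℂ} (hF : IsLogDeriv F f) (hG : IsLogDeriv G g)
    (hf : constantCoeff f = 1) (hg : constantCoeff g = 1) {N : ℕ}
    (h : ∀ k ≤ N, coeff k f = coeff k g) : ∀ k ≤ N, coeff k F = coeff k G := by
  intro k
  induction k using Nat.strong_induction_on with
  | _ k ih =>
    intro hk
    cases k with
    | zero => simp [hF.constantCoeff_eq_zero hf, hG.constantCoeff_eq_zero hg]
    | succ n =>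
      have h1 := hF.coeff_succ hf n
      have h2 := hG.coeff_succ hg n
      rw [h _ hk, h2, Finset.Nat.sum_antidiagonal_eq_sum_range_succ_mk,
        Finset.Nat.sum_antidiagonal_eq_sum_range_succ_mk, Finset.sum_range_succ,
        Finset.sum_range_succ] at h1
      simp only [Nat.sub_self, coeff_zero_eq_constantCoeff_apply, hf, hg, mul_one] at h1
      -- The split-off term `x = n` is the top coefficient of the logarithmic derivative times the
      -- constant term 1; all other terms agree by induction.
      have e : ∑ x ∈ Finset.range n, coeff (x + 1) G * coeff (n - x) g =
          ∑ x ∈ Finset.range n, coeff (x + 1) F * coeff (n - x) f := by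
        refine Finset.sum_congr rfl fun x hx => ?_
        have := Finset.mem_range.1 hx
        rw [ih (x + 1) (by omega) (by omega), h _ (by omega)]
      rw [e] at h1
      exact (add_left_cancel h1).symm

end IsLogDeriv

/-! ### The map `z (d/dz) log` -/

theorem ZSeries.ext_coeff {f g : ZSeries}
    (h : ∀ n : ℕ+, coeff (n : ℕ) f.series = coeff (n : ℕ) g.series) : f = g := by
  refine ZSeries.ext (PowerSeries.ext fun n => ?_)
  rcases Nat.eq_zero_or_pos n with rfl | hn
  · simp [f.const, g.const]
  · exact h ⟨n, hn⟩

theorem zdlog_injective : Function.Injective zdlog := by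
  intro f g h
  refine Lambda.ext (PowerSeries.ext fun n => ?_)
  exact (isLogDeriv_zdlog f).coeff_eq (isLogDeriv_zdlog g) f.const g.const
    (fun k _ => by rw [h]) n le_rfl

theorem zdlog_series_eq {F : PowerSeries ℂ} {f : Lambda} (h : IsLogDeriv F f.series) :
    (zdlog f).series = F := by
  ext n
  exact (isLogDeriv_zdlog f).coeff_eq' h f.const f.const (fun k _ => rfl) n le_rfl

theorem zdlog_add (f g : Lambda) : zdlog (f + g) = zdlog f + zdlog g :=
  ZSeries.ext (zdlog_series_eq ((isLogDeriv_zdlog f).mul (isLogDeriv_zdlog g)))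

/-! ### Factors of the infinite products -/

/-- The series `(1 - a zⁿ)⁻¹`. -/
def geomSeries (n : ℕ) (a : ℂ) : PowerSeries ℂ :=
  PowerSeries.mk fun m => if n ∣ m then a ^ (m / n) else 0

theorem one_sub_mul_geomSeries {n : ℕ} (hn : 0 < n) (a : ℂ) :
    (1 - C a * X ^ n) * geomSeries n a = 1 := by
  ext m
  rw [sub_mul, one_mul, mul_assoc, map_sub, coeff_C_mul, coeff_X_pow_mul', geomSeries, coeff_mk,
    coeff_one]
  by_cases hm : n ≤ m
  · have h0 : m ≠ 0 := by omega
    obtain ⟨k, rfl⟩ := Nat.exists_eq_add_of_le hm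
    have h1 : (n + k) / n = k / n + 1 := Nat.add_div_left k hn
    by_cases hd : n ∣ k
    · have : ¬(n = 0 ∧ k = 0) := by omega
      simp [hd, this, h1, pow_succ, mul_comm]
    · have : ¬(n = 0 ∧ k = 0) := by omega
      simp [hd, this]
  · rcases Nat.eq_zero_or_pos m with rfl | h0
    · simp [hn.ne']
    · have : ¬ n ∣ m := fun h => hm (Nat.le_of_dvd h0 h)
      simp [hm, this, h0.ne']

theorem inv_one_sub_eq_geomSeries {n : ℕ} (hn : 0 < n) (a : ℂ) :
    (1 - C a * X ^ n : PowerSeries ℂ)⁻¹ = geomSeries n a := by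
  rw [PowerSeries.inv_eq_iff_mul_eq_one (by simp [hn.ne']), mul_comm]
  exact one_sub_mul_geomSeries hn a

theorem constantCoeff_geomSeries (n : ℕ) (a : ℂ) : constantCoeff (geomSeries n a) = 1 := by
  rw [← coeff_zero_eq_constantCoeff_apply]
  simp [geomSeries]

theorem coeff_C_mul_geomSeries_sub_one (n : ℕ) (c a : ℂ) (m : ℕ+) :
    coeff (m : ℕ) (C c * (geomSeries n a - 1)) =
      if n ∣ (m : ℕ) then c * a ^ ((m : ℕ) / n) else 0 := by
  simp [geomSeries, coeff_one]

/-- For `G = (1 - a zⁿ)⁻¹`, `z G'/G = n a zⁿ/(1 - a zⁿ) = n (G - 1)`; the proof differentiates `(1 -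
a zⁿ) G = 1`. -/
theorem isLogDeriv_geomSeries {n : ℕ} (hn : 0 < n) (a : ℂ) :
    IsLogDeriv (C (n : ℂ) * (geomSeries n a - 1)) (geomSeries n a) := by
  have h := one_sub_mul_geomSeries hn a
  have hX : (X : PowerSeries ℂ) * X ^ (n - 1) = X ^ n := by
    rw [← pow_succ', Nat.sub_add_cancel hn]
  have hd := congrArg (PowerSeries.derivative ℂ) h
  rw [Derivation.leibniz, map_sub, PowerSeries.derivative_one, Derivation.leibniz,
    PowerSeries.derivative_C, PowerSeries.derivative_pow, PowerSeries.derivative_X] at hd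
  simp only [smul_eq_mul, mul_zero, add_zero, zero_sub, mul_one] at hd
  have hC : (C (n : ℂ) : PowerSeries ℂ) = (n : PowerSeries ℂ) := by simp
  unfold IsLogDeriv
  rw [hC]
  linear_combination (-X * geomSeries n a) * hd +
    (X * PowerSeries.derivative ℂ (geomSeries n a) + n * geomSeries n a) * h -
    n * C a * (geomSeries n a) ^ 2 * hX

/-! ### The binomial series -/

theorem succ_mul_choose_succ (r : ℂ) (n : ℕ) :
    ((n : ℂ) + 1) * Ring.choose r (n + 1) = (r - n) * Ring.choose r n := by
  have h1 := Ring.descPochhammer_eq_factorial_smul_choose r (n + 1)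
  have h2 := Ring.descPochhammer_eq_factorial_smul_choose r n
  rw [descPochhammer_succ_right, Polynomial.smeval_mul, h2, Polynomial.smeval_sub,
    Polynomial.smeval_X, Polynomial.smeval_natCast, Nat.factorial_succ] at h1
  have hn : (n.factorial : ℂ) ≠ 0 := by exact_mod_cast n.factorial_ne_zero
  apply mul_left_cancel₀ hn
  simp only [nsmul_eq_mul, pow_one, pow_zero, mul_one, Nat.cast_mul, Nat.cast_add,
    Nat.cast_one] at h1
  linear_combination -h1

theorem one_add_X_mul_derivative_binomialSeries (r : ℂ) :
    (1 + X) * PowerSeries.derivative ℂ (PowerSeries.binomialSeries ℂ r) =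
      C r * PowerSeries.binomialSeries ℂ r := by
  ext n
  have h := succ_mul_choose_succ r n
  rw [add_mul, one_mul, map_add, coeff_derivative, coeff_C_mul]
  cases n with
  | zero => simp
  | succ n =>
    rw [coeff_succ_X_mul, coeff_derivative]
    simp only [binomialSeries_coeff, smul_eq_mul, mul_one]
    push_cast at h ⊢
    linear_combination h

/-- The differential equation `(1 + X) B' = -α B` at `-zⁿ`, with the chain rule, gives the
logarithmic derivative `n α zⁿ/(1 - zⁿ)`. -/
theorem isLogDeriv_binomialSeries_subst {n : ℕ} (hn : 0 < n) (α : ℂ) :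
    IsLogDeriv (C (n * α) * (geomSeries n 1 - 1))
      ((PowerSeries.binomialSeries ℂ (-α)).subst (-(X ^ n) : PowerSeries ℂ)) := by
  have hs : HasSubst (-(X ^ n) : PowerSeries ℂ) :=
    HasSubst.of_constantCoeff_zero' (by simp [hn.ne'])
  have h1 := congrArg (PowerSeries.subst (-(X ^ n) : PowerSeries ℂ))
    (one_add_X_mul_derivative_binomialSeries (-α))
  have hC : (C (-α) : PowerSeries ℂ) * PowerSeries.binomialSeries ℂ (-α) =
      (-α) • PowerSeries.binomialSeries ℂ (-α) := (PowerSeries.smul_eq_C_mul _ _).symm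
  rw [hC, subst_smul hs, subst_mul hs, subst_add hs, subst_X hs, ← coe_substAlgHom hs, map_one,
    coe_substAlgHom hs, PowerSeries.smul_eq_C_mul] at h1
  have h2 := one_sub_mul_geomSeries hn 1
  have hX : (X : PowerSeries ℂ) * X ^ (n - 1) = X ^ n := by
    rw [← pow_succ', Nat.sub_add_cancel hn]
  unfold IsLogDeriv
  rw [PowerSeries.derivative_subst hs, map_neg, PowerSeries.derivative_pow,
    PowerSeries.derivative_X, mul_one]
  have hC : (C (n * α) : PowerSeries ℂ) = (n : PowerSeries ℂ) * C α := by simp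
  have hC' : (C (-α) : PowerSeries ℂ) = - C α := by simp
  rw [hC'] at h1
  rw [map_one, one_mul] at h2
  rw [hC]
  set B := (PowerSeries.binomialSeries ℂ (-α)).subst (-(X ^ n) : PowerSeries ℂ)
  set B' := (PowerSeries.derivative ℂ (PowerSeries.binomialSeries ℂ (-α))).subst
    (-(X ^ n) : PowerSeries ℂ)
  linear_combination (n * C α * B - n * B' * X ^ n) * h2 + n * X ^ n * geomSeries n 1 * h1 +
    n * B' * hX

theorem X_pow_dvd_subst_sub_one {f : PowerSeries ℂ} (hf : constantCoeff f = 1) {n : ℕ}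
    (hn : 0 < n) : X ^ n ∣ f.subst (-(X ^ n) : PowerSeries ℂ) - 1 := by
  have hs : HasSubst (-(X ^ n) : PowerSeries ℂ) :=
    HasSubst.of_constantCoeff_zero' (by simp [hn.ne'])
  have h := X_mul_divZ f
  rw [hf, map_one] at h
  have h2 := congrArg (PowerSeries.subst (-(X ^ n) : PowerSeries ℂ)) h
  rw [subst_sub hs, subst_mul hs, subst_X hs, ← coe_substAlgHom hs, map_one,
    coe_substAlgHom hs] at h2
  rw [← h2]
  exact (dvd_neg.2 dvd_rfl).mul_right _

theorem X_pow_dvd_geomSeries_sub_one {n : ℕ} (hn : 0 < n) (a : ℂ) :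
    X ^ n ∣ geomSeries n a - 1 := by
  have h := one_sub_mul_geomSeries hn a
  exact ⟨C a * geomSeries n a, by linear_combination h⟩

/-! ### Infinite products -/

theorem X_pow_dvd_prod_sub_one {u : ℕ+ → PowerSeries ℂ} {N : ℕ} (s : Finset ℕ+)
    (h : ∀ n ∈ s, X ^ N ∣ u n - 1) : X ^ N ∣ ∏ n ∈ s, u n - 1 := by
  classical
  induction s using Finset.induction_on with
  | empty => simp
  | insert i s hi ih =>
    rw [Finset.prod_insert hi]
    have e : u i * ∏ n ∈ s, u n - 1 = u i * (∏ n ∈ s, u n - 1) + (u i - 1) := by ring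
    rw [e]
    exact dvd_add ((ih fun j hj => h j (by simp [hj])).mul_left _) (h i (by simp))

/-- The additional factors have index beyond `N` and are 1 modulo `X ^ (N + 1)`. -/
theorem coeff_prod_of_subset {u : ℕ+ → PowerSeries ℂ} (hu : ∀ n : ℕ+, X ^ (n : ℕ) ∣ u n - 1)
    {k : ℕ} {N : ℕ+} (hk : k ≤ N) {s : Finset ℕ+} (hs : Finset.Icc 1 N ⊆ s) :
    coeff k (∏ n ∈ s, u n) = coeff k (∏ n ∈ Finset.Icc 1 N, u n) := by
  classical
  rw [← Finset.prod_sdiff hs, ← sub_eq_zero, ← map_sub, ← sub_one_mul]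
  refine X_pow_dvd_iff.1 (Dvd.dvd.mul_right (X_pow_dvd_prod_sub_one _ fun n hn => ?_) _) k
    (Nat.lt_succ_of_le hk)
  have hn' : N < n := by
    simpa using (Finset.mem_sdiff.1 hn).2
  exact (pow_dvd_pow _ (Nat.succ_le_of_lt hn')).trans (hu n)

theorem coeff_tprod {u : ℕ+ → PowerSeries ℂ} (hu : ∀ n : ℕ+, X ^ (n : ℕ) ∣ u n - 1)
    {k : ℕ} {N : ℕ+} (hk : k ≤ N) :
    coeff k (∏' n, u n) = coeff k (∏ n ∈ Finset.Icc 1 N, u n) := by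
  -- Each coefficient is eventually constant along finite sets, so its stable value gives the limit;
  -- `k.succPNat` is a positive bound also for `k = 0`.
  have h : HasProd u (PowerSeries.mk fun k =>
      coeff k (∏ n ∈ Finset.Icc 1 k.succPNat, u n)) := by
    rw [HasProd, SummationFilter.unconditional_filter,
      PowerSeries.WithPiTopology.tendsto_iff_coeff_tendsto]
    intro d
    refine tendsto_const_nhds.congr' ?_
    filter_upwards [Filter.eventually_ge_atTop (Finset.Icc 1 d.succPNat)] with s hs
    rw [coeff_mk, coeff_prod_of_subset hu (Nat.le_succ d) hs]
  rw [h.tprod_eq, coeff_mk]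
  rcases le_total k.succPNat N with h1 | h1
  · exact (coeff_prod_of_subset hu (Nat.le_succ k) (Finset.Icc_subset_Icc_right h1)).symm
  · exact coeff_prod_of_subset hu hk (Finset.Icc_subset_Icc_right h1)

/-- The logarithmic derivative of an infinite product. -/
theorem coeff_zdlog_tprod {u F : ℕ+ → PowerSeries ℂ} (hu : ∀ n : ℕ+, X ^ (n : ℕ) ∣ u n - 1)
    (hF : ∀ n, IsLogDeriv (F n) (u n)) {f : Lambda} (hf : f.series = ∏' n, u n) (m : ℕ+) :
    coeff (m : ℕ) (zdlog f).series = ∑ n ∈ Finset.Icc 1 m, coeff (m : ℕ) (F n) := by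
  have h := IsLogDeriv.finset_prod (Finset.Icc 1 m) fun n _ => hF n
  have hc : ∀ n, constantCoeff (u n) = 1 := by
    intro n
    have := X_pow_dvd_iff.1 (hu n) 0 n.pos
    simpa [sub_eq_zero] using this
  rw [(isLogDeriv_zdlog f).coeff_eq' h f.const (by simp [hc]) (N := m)
    (fun k hk => by rw [hf, coeff_tprod hu hk]) m le_rfl, map_sum]

/-! ## The commutative diagram on the algebraic side -/

theorem coeff_ghostSeries (x : ℕ+ → ℂ) (n : ℕ+) :
    coeff (n : ℕ) (ghostSeries x).series = x n := by
  rw [ghostSeries, coeff_mk, dif_pos n.pos]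
  rfl

theorem zdlog_gamma (a : Witt) : zdlog (gamma a) = ghostSeries (ghostMap a) := by
  refine ZSeries.ext_coeff fun m => ?_
  rw [coeff_zdlog_tprod (u := fun n : ℕ+ => geomSeries n (a.comp n))
    (F := fun n : ℕ+ => C ((n : ℕ) : ℂ) * (geomSeries n (a.comp n) - 1))
    (fun n => X_pow_dvd_geomSeries_sub_one n.pos _) (fun n => isLogDeriv_geomSeries n.pos _)
    (tprod_congr fun n => inv_one_sub_eq_geomSeries n.pos _), coeff_ghostSeries]
  simp only [coeff_C_mul_geomSeries_sub_one]
  rw [← Finset.sum_filter]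
  rfl

theorem zdlog_necklaceLambda (α : Necklace) :
    zdlog (necklaceLambda α) = ghostSeries (necklaceGhost α) := by
  refine ZSeries.ext_coeff fun m => ?_
  rw [coeff_zdlog_tprod (F := fun n : ℕ+ => C ((n : ℕ) * α.comp n) * (geomSeries n 1 - 1))
    (fun n => X_pow_dvd_subst_sub_one (binomialSeries_constantCoeff _) n.pos)
    (fun n => isLogDeriv_binomialSeries_subst n.pos _) rfl, coeff_ghostSeries]
  simp only [coeff_C_mul_geomSeries_sub_one, one_pow, mul_one]
  rw [← Finset.sum_filter]
  rfl

/-! ## Sums over divisors -/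

theorem mem_divisors {d n : ℕ+} : d ∈ divisors n ↔ d ∣ n := by
  rw [divisors, Finset.mem_filter, ← PNat.dvd_iff, Finset.mem_Icc]
  exact ⟨fun h => h.2, fun h => ⟨⟨one_le, PNat.le_of_dvd h⟩, h⟩⟩

theorem toPNat'_mul_div (m k : ℕ+) : Nat.toPNat' (((m * k : ℕ+) : ℕ) / (m : ℕ)) = k := by
  rw [PNat.mul_coe, Nat.mul_div_cancel_left _ m.pos]
  simp

/-- Chains `m ∣ d ∣ n` correspond to pairs `(m, k)` with `d = m k` and `k ∣ n / m`. -/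
theorem sum_divisors_sum_divisors (n : ℕ+) (G : ℕ+ → ℕ+ → ℂ) :
    ∑ d ∈ divisors n, ∑ m ∈ divisors d, G m (Nat.toPNat' ((d : ℕ) / (m : ℕ))) =
      ∑ m ∈ divisors n, ∑ k ∈ divisors (Nat.toPNat' ((n : ℕ) / (m : ℕ))), G m k := by
  rw [Finset.sum_sigma', Finset.sum_sigma']
  refine Finset.sum_bij' (fun p _ => ⟨p.2, Nat.toPNat' ((p.1 : ℕ) / (p.2 : ℕ))⟩)
    (fun p _ => ⟨p.1 * p.2, p.1⟩) ?_ ?_ ?_ ?_ ?_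
  · rintro ⟨d, m⟩ h
    simp only [Finset.mem_sigma, mem_divisors] at h ⊢
    obtain ⟨⟨j, rfl⟩, ⟨k, rfl⟩⟩ := h
    rw [toPNat'_mul_div, mul_assoc, toPNat'_mul_div]
    exact ⟨dvd_mul_right _ _, dvd_mul_right _ _⟩
  · rintro ⟨m, k⟩ h
    simp only [Finset.mem_sigma, mem_divisors] at h ⊢
    obtain ⟨⟨j, rfl⟩, h⟩ := h
    rw [toPNat'_mul_div] at h
    exact ⟨mul_dvd_mul_left _ h, dvd_mul_right _ _⟩
  · rintro ⟨d, m⟩ h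
    simp only [Finset.mem_sigma, mem_divisors] at h ⊢
    obtain ⟨-, ⟨k, rfl⟩⟩ := h
    rw [toPNat'_mul_div]
  · rintro ⟨m, k⟩ _
    simp only [toPNat'_mul_div]
  · rintro ⟨d, m⟩ _
    rfl

theorem sum_divisors_eq (n : ℕ+) (F : ℕ → ℂ) :
    ∑ d ∈ divisors n, F d = ∑ d ∈ (n : ℕ).divisors, F d := by
  refine Finset.sum_bij (fun d _ => (d : ℕ)) ?_ ?_ ?_ ?_
  · intro d hd
    exact Nat.mem_divisors.2 ⟨PNat.dvd_iff.1 (mem_divisors.1 hd), n.ne_zero⟩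
  · intro a _ b _ h
    exact PNat.coe_injective h
  · intro d hd
    have h := Nat.dvd_of_mem_divisors hd
    exact ⟨⟨d, Nat.pos_of_mem_divisors hd⟩, mem_divisors.2 (PNat.dvd_iff.2 h), rfl⟩
  · intro d _
    rfl

/-- The necklace polynomials satisfy `∑_{k ∣ n} k M (b, k) = bⁿ`. -/
theorem sum_mul_necklaceVector (b : ℂ) (n : ℕ+) :
    ∑ k ∈ divisors n, (k : ℂ) * (necklaceVector b).comp k = b ^ (n : ℕ) := by
  -- Möbius inversion, applied to `k M (b, k) = ∑ μ (i) b ^ j` over `i j = k`.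
  have h := (ArithmeticFunction.sum_eq_iff_sum_mul_moebius_eq
    (f := fun k => ∑ x ∈ k.divisorsAntidiagonal,
      (ArithmeticFunction.moebius x.1 : ℂ) * b ^ x.2) (g := fun n => b ^ n)).2
    (fun _ _ => rfl) n n.pos
  rw [← h, ← sum_divisors_eq n (fun k => ∑ x ∈ k.divisorsAntidiagonal,
      (ArithmeticFunction.moebius x.1 : ℂ) * b ^ x.2)]
  refine Finset.sum_congr rfl fun k _ => ?_
  have hk : (k : ℂ) ≠ 0 := by exact_mod_cast k.ne_zero
  rw [Nat.sum_divisorsAntidiagonal' (f := fun i j => (ArithmeticFunction.moebius i : ℂ) * b ^ j),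
    ← sum_divisors_eq k (fun d => (ArithmeticFunction.moebius ((k : ℕ) / d) : ℂ) * b ^ d)]
  simp only [necklaceVector]
  field_simp

theorem wittToNecklace_comp (a : Witt) (d : ℕ+) :
    (wittToNecklace a).comp d = ∑ m ∈ divisors d,
      (necklaceVector (a.comp m)).comp (Nat.toPNat' ((d : ℕ) / (m : ℕ))) := by
  simp only [wittToNecklace, verschiebung]
  rw [finsum_eq_sum_of_support_subset (s := divisors d)]
  · exact Finset.sum_congr rfl fun m hm => if_pos (PNat.dvd_iff.1 (mem_divisors.1 hm))
  · intro m hm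
    by_contra h
    exact hm (if_neg fun h' => h (mem_divisors.2 (PNat.dvd_iff.2 h')))

/-- For `m ∣ n`, the summand `V_m 𝐌 (a_m)` has `n`-th ghost component `m a_m ^ (n / m)`: `V_m`
contributes the factor `m`, and the necklace polynomials sum to a power. -/
theorem necklaceGhost_wittToNecklace (a : Witt) :
    necklaceGhost (wittToNecklace a) = ghostMap a := by
  funext n
  have h := sum_divisors_sum_divisors n
    (fun m k => ((m : ℂ) * (k : ℂ)) * (necklaceVector (a.comp m)).comp k)
  calc necklaceGhost (wittToNecklace a) n = ∑ d ∈ divisors n, ∑ m ∈ divisors d,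
        ((m : ℂ) * ((Nat.toPNat' ((d : ℕ) / (m : ℕ)) : ℕ+) : ℂ)) *
          (necklaceVector (a.comp m)).comp (Nat.toPNat' ((d : ℕ) / (m : ℕ))) := by
        refine Finset.sum_congr rfl fun d _ => ?_
        rw [wittToNecklace_comp, Finset.mul_sum]
        refine Finset.sum_congr rfl fun m hm => ?_
        obtain ⟨k, rfl⟩ := mem_divisors.1 hm
        rw [toPNat'_mul_div]
        push_cast
        rfl
    _ = _ := h
    _ = ghostMap a n := by
        refine Finset.sum_congr rfl fun m hm => ?_
        obtain ⟨k, rfl⟩ := mem_divisors.1 hm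
        rw [toPNat'_mul_div, PNat.mul_coe, Nat.mul_div_cancel_left _ m.pos,
          ← sum_mul_necklaceVector, Finset.mul_sum]
        exact Finset.sum_congr rfl fun k _ => mul_assoc _ _ _

/-! ## Triangular systems -/

/-- The solution of a triangular system `n aₙ + Hₙ (a₁, …, aₙ₋₁) = yₙ`. -/
def triangularSolution (H : ℕ+ → (ℕ+ → ℂ) → ℂ) (y : ℕ+ → ℂ) (n : ℕ+) : ℂ :=
  (y n - H n fun k => if k < n then triangularSolution H y k else 0) / n
termination_by n

theorem triangular_bijective (H : ℕ+ → (ℕ+ → ℂ) → ℂ)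
    (hH : ∀ n a b, (∀ k < n, a k = b k) → H n a = H n b) :
    Function.Bijective fun (a : ℕ+ → ℂ) (n : ℕ+) => (n : ℂ) * a n + H n a := by
  have hn : ∀ n : ℕ+, (n : ℂ) ≠ 0 := fun n => by exact_mod_cast n.ne_zero
  refine ⟨fun a b h => ?_, fun y => ⟨triangularSolution H y, ?_⟩⟩
  · funext n
    induction n using PNat.strongInductionOn with
    | _ n ih =>
      have h1 : (n : ℂ) * a n + H n a = (n : ℂ) * b n + H n b := congrFun h n
      rw [hH n a b ih] at h1
      exact mul_left_cancel₀ (hn n) (add_right_cancel h1)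
  · funext n
    change (n : ℂ) * triangularSolution H y n + H n (triangularSolution H y) = y n
    -- The recursive definition feeds `H n` the solution cut off to 0 from `n` on; `H n` sees only
    -- indices below `n`.
    rw [hH n (triangularSolution H y)
      (fun k => if k < n then triangularSolution H y k else 0) fun k hk => (if_pos hk).symm]
    rw [triangularSolution, mul_div_cancel₀ _ (hn n), sub_add_cancel]

theorem self_mem_divisors (n : ℕ+) : n ∈ divisors n := mem_divisors.2 dvd_rfl

theorem lt_of_mem_divisors_erase {n d : ℕ+} (h : d ∈ (divisors n).erase n) : d < n :=
  lt_of_le_of_ne (PNat.le_of_dvd (mem_divisors.1 (Finset.mem_of_mem_erase h)))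
    (Finset.ne_of_mem_erase h)

theorem ghostMap_bijective : Function.Bijective ghostMap := by
  have h := triangular_bijective
    (fun n a => ∑ d ∈ (divisors n).erase n, (d : ℂ) * a d ^ ((n : ℕ) / (d : ℕ)))
    (fun n a b hab => Finset.sum_congr rfl fun d hd => by
      rw [hab d (lt_of_mem_divisors_erase hd)])
  have hc : Function.Bijective Witt.comp :=
    ⟨fun a b hab => Witt.ext hab, fun x => ⟨⟨x⟩, rfl⟩⟩
  convert h.comp hc using 1
  funext a n
  rw [ghostMap, ← Finset.add_sum_erase _ _ (self_mem_divisors n), Nat.div_self n.pos, pow_one]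
  rfl

theorem necklaceGhost_bijective : Function.Bijective necklaceGhost := by
  have h := triangular_bijective
    (fun n a => ∑ d ∈ (divisors n).erase n, (d : ℂ) * a d)
    (fun n a b hab => Finset.sum_congr rfl fun d hd => by
      rw [hab d (lt_of_mem_divisors_erase hd)])
  have hc : Function.Bijective Necklace.comp :=
    ⟨fun a b hab => Necklace.ext hab, fun x => ⟨⟨x⟩, rfl⟩⟩
  convert h.comp hc using 1
  funext a n
  rw [necklaceGhost, ← Finset.add_sum_erase _ _ (self_mem_divisors n)]
  rfl

theorem ghostSeries_bijective : Function.Bijective ghostSeries :=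
  ⟨fun x y h => funext fun n => by rw [← coeff_ghostSeries x, h, coeff_ghostSeries],
    fun f => ⟨fun n => coeff (n : ℕ) f.series, ZSeries.ext_coeff fun n => coeff_ghostSeries _ n⟩⟩

/-- Surjectivity is inherited from `zdlog ∘ gamma`, a composite of known bijections; no exponential
series has to be constructed. -/
theorem zdlog_bijective : Function.Bijective zdlog := by
  refine ⟨zdlog_injective, Function.Surjective.of_comp (g := gamma) ?_⟩
  have h : zdlog ∘ gamma = ghostSeries ∘ ghostMap := funext zdlog_gamma
  rw [h]
  exact ghostSeries_bijective.surjective.comp ghostMap_bijective.surjective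

theorem gamma_bijective : Function.Bijective gamma := by
  have h : zdlog ∘ gamma = ghostSeries ∘ ghostMap := funext zdlog_gamma
  refine (zdlog_bijective.of_comp_iff' _).1 ?_
  rw [h]
  exact ghostSeries_bijective.comp ghostMap_bijective

/-! ## Compatibility with the ring operations -/

theorem coeff_ZSeries_mul (f g : ZSeries) (n : ℕ) :
    coeff n (f * g).series = coeff n f.series * coeff n g.series :=
  coeff_mk n fun n => coeff n f.series * coeff n g.series

theorem ghostSeries_add (x y : ℕ+ → ℂ) : ghostSeries (x + y) = ghostSeries x + ghostSeries y := by
  refine ZSeries.ext_coeff fun n => ?_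
  have e : (ghostSeries x + ghostSeries y).series =
    (ghostSeries x).series + (ghostSeries y).series := rfl
  rw [e, map_add, coeff_ghostSeries, coeff_ghostSeries, coeff_ghostSeries, Pi.add_apply]

theorem ghostSeries_mul (x y : ℕ+ → ℂ) : ghostSeries (x * y) = ghostSeries x * ghostSeries y := by
  refine ZSeries.ext_coeff fun n => ?_
  rw [coeff_ZSeries_mul, coeff_ghostSeries, coeff_ghostSeries, coeff_ghostSeries, Pi.mul_apply]

theorem necklaceGhost_add (α β : Necklace) :
    necklaceGhost (α + β) = necklaceGhost α + necklaceGhost β := by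
  funext n
  rw [Pi.add_apply, necklaceGhost, necklaceGhost, necklaceGhost, ← Finset.sum_add_distrib]
  exact Finset.sum_congr rfl fun d _ => mul_add _ _ _

/-- Pairs of divisors of `n` are grouped by their lcm `d`, again a divisor of `n`; then `d gcd(i,j)
= ij`. -/
theorem necklaceGhost_mul (α β : Necklace) :
    necklaceGhost (α * β) = necklaceGhost α * necklaceGhost β := by
  funext n
  have hmaps : ∀ p ∈ divisors n ×ˢ divisors n, PNat.lcm p.1 p.2 ∈ divisors n := by
    intro p hp
    rw [Finset.mem_product, mem_divisors, mem_divisors] at hp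
    exact mem_divisors.2 (PNat.lcm_dvd hp.1 hp.2)
  rw [Pi.mul_apply, necklaceGhost, necklaceGhost, necklaceGhost, Finset.sum_mul_sum,
    ← Finset.sum_product', ← Finset.sum_fiberwise_of_maps_to hmaps]
  refine Finset.sum_congr rfl fun d hd => ?_
  have e : (α * β).comp d = ∑ p ∈ ((Finset.Icc 1 d) ×ˢ (Finset.Icc 1 d)).filter
      (fun p => PNat.lcm p.1 p.2 = d),
      ((PNat.gcd p.1 p.2 : ℕ+) : ℂ) * α.comp p.1 * β.comp p.2 := rfl
  rw [e, Finset.mul_sum]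
  refine Finset.sum_congr ?_ ?_
  · ext p
    simp only [Finset.mem_filter, Finset.mem_product, Finset.mem_Icc, mem_divisors]
    constructor
    · rintro ⟨-, rfl⟩
      have := mem_divisors.1 hd
      exact ⟨⟨(PNat.dvd_lcm_left _ _).trans this, (PNat.dvd_lcm_right _ _).trans this⟩, rfl⟩
    · rintro ⟨-, rfl⟩
      exact ⟨⟨⟨one_le, PNat.le_of_dvd (PNat.dvd_lcm_left _ _)⟩,
        ⟨one_le, PNat.le_of_dvd (PNat.dvd_lcm_right _ _)⟩⟩, rfl⟩
  · intro p hp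
    have hp2 := (Finset.mem_filter.1 hp).2
    have h : ((PNat.gcd p.1 p.2 : ℕ+) : ℂ) * ((PNat.lcm p.1 p.2 : ℕ+) : ℂ) =
        (p.1 : ℂ) * (p.2 : ℂ) := by
      exact_mod_cast congrArg (fun x : ℕ+ => (x : ℕ)) (PNat.gcd_mul_lcm p.1 p.2)
    rw [hp2] at h
    linear_combination α.comp p.1 * β.comp p.2 * h

/-! ### The product of `Λ(ℂ)` -/

/-- A complex polynomial with constant coefficient `1` is the product of the `1 - ξ z` over the
roots `ξ` of the reversed polynomial. -/
theorem prod_one_sub_roots_reverse {p : Polynomial ℂ} (hp : p.coeff 0 = 1) :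
    (p.reverse.roots.map fun ξ => 1 - Polynomial.C ξ * Polynomial.X).prod = p := by
  have hlead : p.reverse.leadingCoeff = 1 := by
    rw [Polynomial.reverse_leadingCoeff, Polynomial.trailingCoeff,
      Polynomial.natTrailingDegree_eq_zero.2 (Or.inr (by simp [hp])), hp]
  -- A nonzero constant coefficient keeps the degree under reversal, so that reversing twice loses
  -- nothing.
  have hrev : p.reverse.reverse = p := by
    have hdeg : p.reverse.natDegree = p.natDegree := by
      rw [Polynomial.reverse_natDegree,
        Polynomial.natTrailingDegree_eq_zero.2 (Or.inr (by simp [hp])), Nat.sub_zero]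
    ext n
    rw [Polynomial.coeff_reverse, Polynomial.coeff_reverse, hdeg, Polynomial.revAt_invol]
  have hprod : ∀ s : Multiset ℂ, (s.map fun ξ => Polynomial.X - Polynomial.C ξ).prod.reverse =
      (s.map fun ξ => 1 - Polynomial.C ξ * Polynomial.X).prod := by
    intro s
    induction s using Multiset.induction_on with
    | empty =>
      rw [Multiset.map_zero, Multiset.map_zero, Multiset.prod_zero, ← Polynomial.C_1,
        Polynomial.reverse_C]
    | cons ξ s ih =>
      rw [Multiset.map_cons, Multiset.map_cons, Multiset.prod_cons, Multiset.prod_cons,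
        Polynomial.reverse_mul_of_domain, ih]
      congr 1
      have h1 : (Polynomial.X - Polynomial.C ξ : Polynomial ℂ) =
          Polynomial.C (-ξ) + 1 * Polynomial.X := by
        rw [map_neg]; ring
      rw [h1, Polynomial.reverse_C_add, ← Polynomial.C_1, Polynomial.reverse_mul_X,
        Polynomial.reverse_C, Polynomial.natDegree_mul_X (by simp), Polynomial.natDegree_C,
        zero_add, pow_one, map_neg]
      simp
      ring
  have hs := (IsAlgClosed.splits p.reverse).eq_prod_roots
  rw [hlead, map_one, one_mul] at hs
  rw [← hprod, ← hs, hrev]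

/-- The factorisation of a power series up to some order. -/
theorem coeff_prod_formalRoots (n : ℕ) (f : Lambda) : ∀ k ≤ n,
    coeff k ((formalRoots n f.series).map (geomSeries 1)).prod = coeff k f.series := by
  set p := PowerSeries.trunc (n + 1) f.series⁻¹ with hp
  have hp0 : p.coeff 0 = 1 := by
    simp [hp, PowerSeries.coeff_trunc, PowerSeries.constantCoeff_inv, f.const]
  have h1 : ((formalRoots n f.series).map fun ξ => (1 - C ξ * X : PowerSeries ℂ)).prod = p := by
    have := congrArg (Polynomial.coeToPowerSeries.ringHom (R := ℂ)) (prod_one_sub_roots_reverse hp0)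
    rw [map_multiset_prod, Multiset.map_map] at this
    simpa [formalRoots, Function.comp_def] using this
  have h2 : ((formalRoots n f.series).map fun ξ => (1 - C ξ * X : PowerSeries ℂ)).prod *
      ((formalRoots n f.series).map (geomSeries 1)).prod = 1 := by
    rw [← Multiset.prod_map_mul]
    refine Multiset.prod_eq_one fun x hx => ?_
    obtain ⟨ξ, -, rfl⟩ := Multiset.mem_map.1 hx
    simpa using one_sub_mul_geomSeries one_pos ξ
  rw [h1] at h2
  set E := ((formalRoots n f.series).map (geomSeries 1)).prod
  have h3 : X ^ (n + 1) ∣ (p : PowerSeries ℂ) - f.series⁻¹ := by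
    rw [X_pow_dvd_iff]
    intro m hm
    simp [hp, PowerSeries.coeff_trunc, hm]
  -- From `E p = 1` and `f f⁻¹ = 1`: the error of `E` is a multiple of the error of the truncation
  -- `p` of `f⁻¹`.
  have h4 : E - f.series = -(E * f.series) * ((p : PowerSeries ℂ) - f.series⁻¹) := by
    linear_combination f.series * h2 - E * f.mul_inv_series
  intro k hk
  rw [← sub_eq_zero, ← map_sub, h4]
  exact X_pow_dvd_iff.1 (h3.mul_left _) k (Nat.lt_succ_of_le hk)

theorem coeff_zdlog_eq_sum_formalRoots (n : ℕ) (f : Lambda) (k : ℕ) (hk : k ≤ n) (h0 : k ≠ 0) :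
    coeff k (zdlog f).series = ((formalRoots n f.series).map fun ξ => ξ ^ k).sum := by
  have hE := IsLogDeriv.multiset_prod (formalRoots n f.series)
    (fun ξ => isLogDeriv_geomSeries one_pos ξ)
  have hc : constantCoeff ((formalRoots n f.series).map (geomSeries 1)).prod = 1 := by
    have := coeff_prod_formalRoots n f 0 (Nat.zero_le n)
    simpa [f.const] using this
  rw [(isLogDeriv_zdlog f).coeff_eq' hE f.const hc
    (fun k hk => (coeff_prod_formalRoots n f k hk).symm) k hk, map_multiset_sum, Multiset.map_map]
  congr 1
  refine Multiset.map_congr rfl fun ξ _ => ?_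
  simpa using coeff_C_mul_geomSeries_sub_one 1 1 ξ ⟨k, Nat.pos_of_ne_zero h0⟩

theorem sum_map_product_pow (s t : Multiset ℂ) (k : ℕ) :
    ((s ×ˢ t).map fun p => (p.1 * p.2) ^ k).sum =
      (s.map fun ξ => ξ ^ k).sum * (t.map fun η => η ^ k).sum := by
  induction s using Multiset.induction_on with
  | empty => simp
  | cons ξ s ih =>
    rw [Multiset.cons_product, Multiset.map_add, Multiset.sum_add, ih, Multiset.map_cons,
      Multiset.sum_cons, add_mul, Multiset.map_map]
    simp only [Function.comp_def, mul_pow, Multiset.sum_map_mul_left]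

/-- The roots that compute the `n`-th coefficient of `f ∗ g` change with `n`. Hence the comparison,
for each `n` separately, with the series `h` whose logarithmic derivative is the desired product: up
to order `n` both have the power sums of the `ξᵢ ηⱼ`. -/
theorem zdlog_mul (f g : Lambda) : zdlog (f * g) = zdlog f * zdlog g := by
  obtain ⟨h, hh⟩ := zdlog_bijective.surjective (zdlog f * zdlog g)
  rw [← hh]
  congr 1
  refine Lambda.ext (PowerSeries.ext fun n => ?_)
  have e : coeff n (f * g).series = coeff n
      (((formalRoots n f.series) ×ˢ (formalRoots n g.series)).map
        fun p => geomSeries 1 (p.1 * p.2)).prod := by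
    have e1 : (f * g).series = lambdaMul f.series g.series := rfl
    rw [e1, lambdaMul, coeff_mk]
    congr 3
    funext p
    simpa using inv_one_sub_eq_geomSeries one_pos (p.1 * p.2)
  rw [e]
  have hE := IsLogDeriv.multiset_prod ((formalRoots n f.series) ×ˢ (formalRoots n g.series))
    (fun p : ℂ × ℂ => isLogDeriv_geomSeries one_pos (p.1 * p.2))
  have hc : constantCoeff (((formalRoots n f.series) ×ˢ (formalRoots n g.series)).map
        fun p => geomSeries 1 (p.1 * p.2)).prod = 1 := by
    rw [map_multiset_prod]
    refine Multiset.prod_eq_one fun x hx => ?_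
    simp only [Multiset.map_map, Multiset.mem_map] at hx
    obtain ⟨p, -, rfl⟩ := hx
    exact constantCoeff_geomSeries _ _
  refine hE.coeff_eq (isLogDeriv_zdlog h) hc h.const (fun k hk => ?_) n le_rfl
  by_cases h0 : k = 0
  · subst h0
    rw [coeff_zero_eq_constantCoeff_apply, coeff_zero_eq_constantCoeff_apply,
      hE.constantCoeff_eq_zero hc, (zdlog h).const]
  · rw [hh, coeff_ZSeries_mul, coeff_zdlog_eq_sum_formalRoots n f k hk h0,
      coeff_zdlog_eq_sum_formalRoots n g k hk h0, ← sum_map_product_pow, map_multiset_sum,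
      Multiset.map_map]
    congr 1
    refine Multiset.map_congr rfl fun p _ => ?_
    simpa using coeff_C_mul_geomSeries_sub_one 1 1 (p.1 * p.2) ⟨k, Nat.pos_of_ne_zero h0⟩

/-! ## The ring isomorphisms -/

theorem gamma_add (a b : Witt) : gamma (a + b) = gamma a + gamma b :=
  Function.rightInverse_invFun gamma_bijective.surjective _

theorem gamma_mul (a b : Witt) : gamma (a * b) = gamma a * gamma b :=
  Function.rightInverse_invFun gamma_bijective.surjective _

theorem rTransform_mul (μ ν : Law) : rTransform (μ * ν) = rTransform μ * rTransform ν :=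
  Function.rightInverse_invFun rTransform_bijective.surjective _

theorem sTransform_mul (μ ν : LawOne) : sTransform (μ * ν) = sTransform μ * sTransform ν :=
  Function.rightInverse_invFun sTransform_bijective.surjective _

/-- A bijection compatible with the operations, as a ring isomorphism. -/
def ringEquivOfBijective {R S : Type*} [Add R] [Mul R] [Add S] [Mul S] (φ : R → S)
    (h : Function.Bijective φ) (hadd : ∀ a b, φ (a + b) = φ a + φ b)
    (hmul : ∀ a b, φ (a * b) = φ a * φ b) : R ≃+* S :=
  { Equiv.ofBijective φ h with
    map_add' := hadd
    map_mul' := hmul }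

theorem isCommUnitalRing_of_ringEquiv {R S : Type*} [Add R] [Mul R] [CommRing S] (e : R ≃+* S) :
    IsCommUnitalRing R :=
  ⟨e.toEquiv.commRing, fun a b => e.injective <| by
      rw [map_add]
      exact e.apply_symm_apply _,
    fun a b => e.injective <| by
      rw [map_mul]
      exact e.apply_symm_apply _⟩

/-- `γ` as a ring isomorphism. -/
def gammaEquiv : Witt ≃+* Lambda :=
  ringEquivOfBijective gamma gamma_bijective gamma_add gamma_mul

/-- `γʷ` as a ring isomorphism. -/
def ghostSeriesEquiv : (ℕ+ → ℂ) ≃+* ZSeries :=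
  ringEquivOfBijective ghostSeries ghostSeries_bijective ghostSeries_add ghostSeries_mul

/-- `z (d/dz) log` as a ring isomorphism. -/
def zdlogEquiv : Lambda ≃+* ZSeries :=
  ringEquivOfBijective zdlog zdlog_bijective zdlog_add zdlog_mul

/-- `g` as a ring isomorphism. -/
def necklaceGhostEquiv : Necklace ≃+* (ℕ+ → ℂ) :=
  ringEquivOfBijective necklaceGhost necklaceGhost_bijective necklaceGhost_add necklaceGhost_mul

/-- The `R`-transform as a ring isomorphism. -/
def rTransformEquiv : Law ≃+* ZSeries :=
  ringEquivOfBijective rTransform rTransform_bijective rTransform_add rTransform_mul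

/-- The `S`-transform as a ring isomorphism. -/
def sTransformEquiv : LawOne ≃+* Lambda :=
  ringEquivOfBijective sTransform sTransform_bijective sTransform_add sTransform_mul

/-- `w` as a ring isomorphism. -/
def ghostMapEquiv : Witt ≃+* (ℕ+ → ℂ) :=
  (gammaEquiv.trans zdlogEquiv).trans ghostSeriesEquiv.symm

/-- Since `zdlog ∘ γ = γʷ ∘ w`, the ghost map is a composite of ring isomorphisms; its compatibility
with the transported operations needs no direct check. -/
theorem ghostMapEquiv_apply (a : Witt) : ghostMapEquiv a = ghostMap a :=
  (congrArg ghostSeriesEquiv.symm (zdlog_gamma a)).trans (ghostSeriesEquiv.symm_apply_apply _)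

/-- `f` as a ring isomorphism. -/
def wittToNecklaceEquiv : Witt ≃+* Necklace := ghostMapEquiv.trans necklaceGhostEquiv.symm

theorem wittToNecklaceEquiv_apply (a : Witt) : wittToNecklaceEquiv a = wittToNecklace a :=
  (congrArg necklaceGhostEquiv.symm
    ((ghostMapEquiv_apply a).trans (necklaceGhost_wittToNecklace a).symm)).trans
    (necklaceGhostEquiv.symm_apply_apply _)

/-- `c` as a ring isomorphism. -/
def necklaceLambdaEquiv : Necklace ≃+* Lambda :=
  (necklaceGhostEquiv.trans ghostSeriesEquiv).trans zdlogEquiv.symm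

theorem necklaceLambdaEquiv_apply (α : Necklace) : necklaceLambdaEquiv α = necklaceLambda α :=
  (congrArg zdlogEquiv.symm (zdlog_necklaceLambda α).symm).trans (zdlogEquiv.symm_apply_apply _)

theorem zdlogEquiv_necklaceLambdaEquiv (α : Necklace) :
    zdlogEquiv (necklaceLambdaEquiv α) = ghostSeriesEquiv (necklaceGhostEquiv α) :=
  zdlogEquiv.apply_symm_apply _

theorem necklaceGhostEquiv_wittToNecklaceEquiv (a : Witt) :
    necklaceGhostEquiv (wittToNecklaceEquiv a) = ghostMapEquiv a :=
  necklaceGhostEquiv.apply_symm_apply _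

theorem zdlogEquiv_gammaEquiv (a : Witt) :
    zdlogEquiv (gammaEquiv a) = ghostSeriesEquiv (ghostMapEquiv a) :=
  (ghostSeriesEquiv.apply_symm_apply _).symm

theorem necklaceLambdaEquiv_wittToNecklaceEquiv (a : Witt) :
    necklaceLambdaEquiv (wittToNecklaceEquiv a) = gammaEquiv a := by
  apply zdlogEquiv.injective
  rw [zdlogEquiv_necklaceLambdaEquiv, necklaceGhostEquiv_wittToNecklaceEquiv,
    zdlogEquiv_gammaEquiv]

end FreeWitt

end

theorem mainTheorem3 :
    -- the free convolutions are well defined on all laws: free copies exist, and the law of the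
    -- sum and of the product of free random variables depends only on their laws
    (∀ μ ν : FreeWitt.Law, ∃ (A : Type) (_ : Ring A) (_ : Algebra ℂ A)
      (P : FreeWitt.NCProbSpace A) (a b : A), P.FreePair a b ∧ P.law a = μ ∧ P.law b = ν) ∧
    (∀ (A : Type*) [Ring A] [Algebra ℂ A] (P : FreeWitt.NCProbSpace A) (a b : A),
      P.FreePair a b → P.law (a + b) = P.law a + P.law b) ∧
    (∀ (A : Type*) [Ring A] [Algebra ℂ A] (P : FreeWitt.NCProbSpace A) (a b : A)
      (μ ν : FreeWitt.LawOne), P.FreePair a b → P.law a = μ.toLaw → P.law b = ν.toLaw →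
        P.law (a * b) = (μ + ν).toLaw) ∧
    -- all the structures are commutative rings with unit
    FreeWitt.IsCommUnitalRing FreeWitt.Witt ∧
    FreeWitt.IsCommUnitalRing FreeWitt.Lambda ∧
    FreeWitt.IsCommUnitalRing FreeWitt.Necklace ∧
    FreeWitt.IsCommUnitalRing (ℕ+ → ℂ) ∧
    FreeWitt.IsCommUnitalRing FreeWitt.ZSeries ∧
    FreeWitt.IsCommUnitalRing FreeWitt.LawOne ∧
    FreeWitt.IsCommUnitalRing FreeWitt.Law ∧
    -- the maps of the diagram are ring isomorphisms
    ∃ (γ : FreeWitt.Witt ≃+* FreeWitt.Lambda) (w : FreeWitt.Witt ≃+* (ℕ+ → ℂ))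
      (f : FreeWitt.Witt ≃+* FreeWitt.Necklace) (g : FreeWitt.Necklace ≃+* (ℕ+ → ℂ))
      (c : FreeWitt.Necklace ≃+* FreeWitt.Lambda) (γw : (ℕ+ → ℂ) ≃+* FreeWitt.ZSeries)
      (e : FreeWitt.Necklace ≃+* FreeWitt.ZSeries) (D : FreeWitt.Lambda ≃+* FreeWitt.ZSeries)
      (S : FreeWitt.LawOne ≃+* FreeWitt.Lambda) (R : FreeWitt.Law ≃+* FreeWitt.ZSeries)
      (LOG : FreeWitt.LawOne ≃+* FreeWitt.Law),
      (∀ a, γ a = FreeWitt.gamma a) ∧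
      (∀ a, w a = FreeWitt.ghostMap a) ∧
      (∀ a, f a = FreeWitt.wittToNecklace a) ∧
      (∀ α, g α = FreeWitt.necklaceGhost α) ∧
      (∀ α, c α = FreeWitt.necklaceLambda α) ∧
      (∀ x, γw x = FreeWitt.ghostSeries x) ∧
      (∀ h, D h = FreeWitt.zdlog h) ∧
      (∀ μ, S μ = FreeWitt.sTransform μ) ∧
      (∀ μ, R μ = FreeWitt.rTransform μ) ∧
      -- the diagram commutes
      (∀ a, c (f a) = γ a) ∧
      (∀ a, g (f a) = w a) ∧
      (∀ α, D (c α) = e α) ∧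
      (∀ α, γw (g α) = e α) ∧
      (∀ a, D (γ a) = γw (w a)) ∧
      (∀ μ, R.symm (D (S μ)) = LOG μ) := by
  refine ⟨fun μ ν => ⟨_, _, _, FreeWitt.Fock.space, _, _, FreeWitt.Fock.freePair_addModel _ _,
      FreeWitt.law_addModel 0 μ, FreeWitt.law_addModel 1 ν⟩,
    fun A _ _ P a b h => FreeWitt.law_add_of_freePair P a b h,
    fun A _ _ P a b μ ν h ha hb => FreeWitt.law_mul_of_freePair P a b μ ν h ha hb,
    FreeWitt.isCommUnitalRing_of_ringEquiv FreeWitt.ghostMapEquiv,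
    FreeWitt.isCommUnitalRing_of_ringEquiv
      (FreeWitt.zdlogEquiv.trans FreeWitt.ghostSeriesEquiv.symm),
    FreeWitt.isCommUnitalRing_of_ringEquiv FreeWitt.necklaceGhostEquiv,
    FreeWitt.isCommUnitalRing_of_ringEquiv (RingEquiv.refl _),
    FreeWitt.isCommUnitalRing_of_ringEquiv FreeWitt.ghostSeriesEquiv.symm,
    FreeWitt.isCommUnitalRing_of_ringEquiv (FreeWitt.sTransformEquiv.trans
      (FreeWitt.zdlogEquiv.trans FreeWitt.ghostSeriesEquiv.symm)),
    FreeWitt.isCommUnitalRing_of_ringEquiv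
      (FreeWitt.rTransformEquiv.trans FreeWitt.ghostSeriesEquiv.symm), ?_⟩
  exact ⟨FreeWitt.gammaEquiv, FreeWitt.ghostMapEquiv, FreeWitt.wittToNecklaceEquiv,
    FreeWitt.necklaceGhostEquiv, FreeWitt.necklaceLambdaEquiv, FreeWitt.ghostSeriesEquiv,
    FreeWitt.necklaceGhostEquiv.trans FreeWitt.ghostSeriesEquiv, FreeWitt.zdlogEquiv,
    FreeWitt.sTransformEquiv, FreeWitt.rTransformEquiv,
    (FreeWitt.sTransformEquiv.trans FreeWitt.zdlogEquiv).trans FreeWitt.rTransformEquiv.symm,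
    fun _ => rfl, FreeWitt.ghostMapEquiv_apply, FreeWitt.wittToNecklaceEquiv_apply, fun _ => rfl,
    FreeWitt.necklaceLambdaEquiv_apply, fun _ => rfl, fun _ => rfl, fun _ => rfl, fun _ => rfl,
    FreeWitt.necklaceLambdaEquiv_wittToNecklaceEquiv,
    FreeWitt.necklaceGhostEquiv_wittToNecklaceEquiv, FreeWitt.zdlogEquiv_necklaceLambdaEquiv,
    fun _ => rfl, FreeWitt.zdlogEquiv_gammaEquiv, fun _ => rfl⟩
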